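/- \textbf{Theorem (Cotton).} Let $M$ be a smooth $3$-manifold (without boundary) with a smooth Riemannian metric $g$, Levi-Civita connection $\nabla$, curvature $R_{U,V}=[\nabla_U,\nabla_V]-\nabla_{[U,V]}$, Ricci tensor $\mathfrak{Ric}(U,V)=\mathrm{tr}[X\mapsto R_{X,U}V]$ and scalar curvature $\mathfrak{scal}=\mathrm{tr}_g\mathfrak{Ric}$. Let $\mathfrak{Sch}=\mathfrak{Ric}-\tfrac{\mathfrak{scal}}{4}g$ be the Schouten tensor, regarded by means of $g$ also as a $1$-form with values in $TM$, and let $\mathfrak{cott}=d^\nabla\mathfrak{Sch}$ be the Cotton form, i.e. the $TM$-valued $2$-form $$\mathfrak{cott}(U,V)=\nabla_U(\mathfrak{Sch}(V))-\nabla_V(\mathfrak{Sch}(U))-\mathfrak{Sch}([U,V]).$$ For a point $x\in M$ and an orientation of $T_xM$, let the Cotton tensor $\mathfrak{Cott}(g)=*\,\mathfrak{cott}$ at $x$ be the bilinear form $(u,v)\mapsto g((*\,\mathfrak{cott})(u),v)$ on $T_xM$, where $*$ is the Hodge star on the form part, given by $*(S^2\wedge S^3)=S^1$, $*(S^3\wedge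 S^1)=S^2$, $*(S^1\wedge S^2)=S^3$ for an oriented $g$-orthonormal basis $S_1,S_2,S_3$ of $T_xM$; reversing the orientation changes its sign. Choose an orientation of each tangent space $T_xM$ in an arbitrary way (if $M$ is oriented, one may take the given orientation; if not, the choice need not be continuous). Then $g$ is locally conformally flat, i.e. every $x\in M$ has an open neighbourhood $V$ with a smooth function $f\in C^\infty(V)$ such that the metric $e^{2f}g$ on $V$ is flat (its curvature tensor vanishes), if and only if $\mathfrak{Cott}(g)$ vanishes at every point of $M$. -/

import Mathlib

set_option maxSynthPendingDepth 3

open scoped Manifold ContDiff Bundle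

noncomputable section

namespace CottonGeometry

/-! ### Riemannian calculus in a coordinate domain

`G : E → E →L[ℝ] E →L[ℝ] ℝ` is a metric written in coordinates: `G y u v` is the scalar product, at
the point with coordinates `y`, of the vectors with components `u` and `v`. Vectors `u v w : E` are
also regarded as coordinate vector fields with constant components (so their brackets vanish). -/

section Coordinates

variable {E : Type*} [NormedAddCommGroup E] [NormedSpace ℝ E]

/-- Exchange of the last two arguments of a trilinear map. -/
def swapLast {E F : Type*} [NormedAddCommGroup E] [NormedSpace ℝ E] [NormedAddCommGroup F]
    [NormedSpace ℝ F] (T : E →L[ℝ] E →L[ℝ] E →L[ℝ] F) : E →L[ℝ] E →L[ℝ] E →L[ℝ] F :=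
  ((ContinuousLinearMap.flipₗᵢ ℝ E E F).toContinuousLinearEquiv.toContinuousLinearMap).comp T

theorem swapLast_apply {E F : Type*} [NormedAddCommGroup E] [NormedSpace ℝ E]
    [NormedAddCommGroup F] [NormedSpace ℝ F] (T : E →L[ℝ] E →L[ℝ] E →L[ℝ] F) (u v w : E) :
    swapLast T u v w = T u w v :=
  rfl

/-- Christoffel symbols of the first kind,
`Γ₁(u, v, z) = ½ (∂_u G(v, z) + ∂_v G(u, z) - ∂_z G(u, v))`. -/
def christoffelFirst (G : E → E →L[ℝ] E →L[ℝ] ℝ) (y : E) : E →L[ℝ] E →L[ℝ] E →L[ℝ] ℝ :=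
  (1 / 2 : ℝ) • (fderiv ℝ G y + (fderiv ℝ G y).flip - swapLast (fderiv ℝ G y).flip)

theorem christoffelFirst_apply (G : E → E →L[ℝ] E →L[ℝ] ℝ) (y u v z : E) :
    christoffelFirst G y u v z =
      (1 / 2 : ℝ) * (fderiv ℝ G y u v z + fderiv ℝ G y v u z - fderiv ℝ G y z u v) :=
  rfl

/-- Raising an index: `sharp G y φ` is the vector `a` with `G y a = φ`. -/
def sharp (G : E → E →L[ℝ] E →L[ℝ] ℝ) (y : E) : (E →L[ℝ] ℝ) →L[ℝ] E :=
  ContinuousLinearMap.inverse (G y)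

/-- Christoffel symbols of the Levi-Civita connection: `christoffel G y u v` is the value at `y` of
`∇_u v` for the vector fields with constant components `u` and `v`. For a general vector field `Y`,
`∇_u Y = ∂_u Y + Γ(u, Y)`. -/
def christoffel (G : E → E →L[ℝ] E →L[ℝ] ℝ) (y : E) : E →L[ℝ] E →L[ℝ] E :=
  (ContinuousLinearMap.compL ℝ E (E →L[ℝ] ℝ) E (sharp G y)).comp (christoffelFirst G y)

theorem christoffel_apply (G : E → E →L[ℝ] E →L[ℝ] ℝ) (y u v : E) :
    christoffel G y u v = sharp G y (christoffelFirst G y u v) :=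
  rfl

/-- `(u, v, w) ↦ ∇_u ∇_v w` for vector fields with constant components. -/
def secondDerivative (G : E → E →L[ℝ] E →L[ℝ] ℝ) (y : E) : E →L[ℝ] E →L[ℝ] E →L[ℝ] E :=
  fderiv ℝ (christoffel G) y +
    (ContinuousLinearMap.compL ℝ E E E).bilinearComp (christoffel G y) (christoffel G y)

theorem secondDerivative_apply (G : E → E →L[ℝ] E →L[ℝ] ℝ) (y u v w : E) :
    secondDerivative G y u v w =
      fderiv ℝ (christoffel G) y u v w + christoffel G y u (christoffel G y v w) :=
  rfl

/-- The curvature tensor `R_{u,v} w = ∇_u ∇_v w - ∇_v ∇_u w - ∇_[u,v] w`. -/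
def riemann (G : E → E →L[ℝ] E →L[ℝ] ℝ) (y : E) : E →L[ℝ] E →L[ℝ] E →L[ℝ] E :=
  secondDerivative G y - (secondDerivative G y).flip

theorem riemann_apply (G : E → E →L[ℝ] E →L[ℝ] ℝ) (y u v w : E) :
    riemann G y u v w = secondDerivative G y u v w - secondDerivative G y v u w :=
  rfl

/-- The trace of an endomorphism. -/
def traceCLM (E : Type*) [NormedAddCommGroup E] [NormedSpace ℝ E] [FiniteDimensional ℝ E] :
    (E →L[ℝ] E) →L[ℝ] ℝ :=
  LinearMap.toContinuousLinearMap
    ((LinearMap.trace ℝ E).comp (ContinuousLinearMap.coeLM ℝ : (E →L[ℝ] E) →ₗ[ℝ] E →ₗ[ℝ] E))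

variable [FiniteDimensional ℝ E]

/-- The Ricci tensor `Ric(u, v) = tr (a ↦ R_{a,u} v)`. -/
def ricci (G : E → E →L[ℝ] E →L[ℝ] ℝ) (y : E) : E →L[ℝ] E →L[ℝ] ℝ :=
  (ContinuousLinearMap.compL ℝ E (E →L[ℝ] E) ℝ (traceCLM E)).comp (swapLast (riemann G y).flip)

theorem ricci_apply (G : E → E →L[ℝ] E →L[ℝ] ℝ) (y u v : E) :
    ricci G y u v = LinearMap.trace ℝ E
      { toFun := fun a ↦ riemann G y a u v
        map_add' := by simp
        map_smul' := by simp } :=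
  rfl

/-- The scalar curvature: the trace of the Ricci tensor with respect to the metric. -/
def scal (G : E → E →L[ℝ] E →L[ℝ] ℝ) (y : E) : ℝ :=
  traceCLM E ((sharp G y).comp (ricci G y))

/-- The (three-dimensional) Schouten tensor `Sch = Ric - (scal / 4) g`. -/
def schouten (G : E → E →L[ℝ] E →L[ℝ] ℝ) (y : E) : E →L[ℝ] E →L[ℝ] ℝ :=
  ricci G y - (scal G y / 4) • G y

/-- The Schouten tensor as a `1`-form with values in vectors: `G (Sch♯ u) v = Sch(u, v)`. -/
def schoutenSharp (G : E → E →L[ℝ] E →L[ℝ] ℝ) (y : E) : E →L[ℝ] E :=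
  (sharp G y).comp (schouten G y)

/-- `(u, v) ↦ ∇_u (Sch♯ v)` for vector fields with constant components. -/
def schoutenDerivative (G : E → E →L[ℝ] E →L[ℝ] ℝ) (y : E) : E →L[ℝ] E →L[ℝ] E :=
  fderiv ℝ (schoutenSharp G) y +
    ((ContinuousLinearMap.compL ℝ E E E).flip (schoutenSharp G y)).comp (christoffel G y)

theorem schoutenDerivative_apply (G : E → E →L[ℝ] E →L[ℝ] ℝ) (y u v : E) :
    schoutenDerivative G y u v =
      fderiv ℝ (schoutenSharp G) y u v + christoffel G y u (schoutenSharp G y v) :=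
  rfl

/-- The Cotton form `cott = d^∇ Sch`, a `2`-form with values in vectors:
`cott(u, v) = ∇_u (Sch♯ v) - ∇_v (Sch♯ u) - Sch♯ [u, v]`. -/
def cottonForm (G : E → E →L[ℝ] E →L[ℝ] ℝ) (y : E) : E →L[ℝ] E →L[ℝ] E :=
  schoutenDerivative G y - (schoutenDerivative G y).flip

theorem cottonForm_apply (G : E → E →L[ℝ] E →L[ℝ] ℝ) (y u v : E) :
    cottonForm G y u v = schoutenDerivative G y u v - schoutenDerivative G y v u :=
  rfl

end Coordinates

/-! ### Tensors on a 3-manifold -/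

section Manifold

variable {M : Type*} [TopologicalSpace M] [ChartedSpace (EuclideanSpace ℝ (Fin 3)) M]

/-- The coordinate expression, in the preferred chart `φ` at `x`, of a field `h` of bilinear forms
on `M`: the pull-back of `h` under `φ⁻¹`. -/
def inChart
    (h : ∀ x : M, TangentSpace (𝓡 3) x →L[ℝ] TangentSpace (𝓡 3) x →L[ℝ] ℝ) (x : M) :
    EuclideanSpace ℝ (Fin 3) →
      EuclideanSpace ℝ (Fin 3) →L[ℝ] EuclideanSpace ℝ (Fin 3) →L[ℝ] ℝ :=
  fun y ↦
    let A : EuclideanSpace ℝ (Fin 3) →L[ℝ] TangentSpace (𝓡 3) ((extChartAt (𝓡 3) x).symm y) :=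
      mfderiv 𝓘(ℝ, EuclideanSpace ℝ (Fin 3)) (𝓡 3) (extChartAt (𝓡 3) x).symm y
    let B : EuclideanSpace ℝ (Fin 3) →L[ℝ] EuclideanSpace ℝ (Fin 3) →L[ℝ] ℝ :=
      h ((extChartAt (𝓡 3) x).symm y)
    B.bilinearComp A A

/-- The tangent space at `x` is by definition the model space, a tangent vector being identified
with its components in the preferred chart at `x`. Correspondingly, the coordinate expression of a
field of bilinear forms in this chart is, at the point `x` itself, the given bilinear form; the
tensors below use the same identification. -/
theorem inChart_self [IsManifold (𝓡 3) ∞ M]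
    (h : ∀ x : M, TangentSpace (𝓡 3) x →L[ℝ] TangentSpace (𝓡 3) x →L[ℝ] ℝ) (x : M)
    (u v : EuclideanSpace ℝ (Fin 3)) :
    inChart h x (extChartAt (𝓡 3) x x) u v = h x u v := by
  have : IsManifold (𝓡 3) 1 M := IsManifold.of_le (n := ∞) (by simp)
  have key : (mfderiv 𝓘(ℝ, EuclideanSpace ℝ (Fin 3)) (𝓡 3) (extChartAt (𝓡 3) x).symm
      (extChartAt (𝓡 3) x x) : EuclideanSpace ℝ (Fin 3) →L[ℝ] EuclideanSpace ℝ (Fin 3)) =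
      ContinuousLinearMap.id ℝ _ := by
    have h1 := mfderivWithin_range_extChartAt_symm (I := 𝓡 3) (x := x)
    rw [ModelWithCorners.range_eq_univ, mfderivWithin_univ] at h1
    exact h1
  have hu : ∀ w : EuclideanSpace ℝ (Fin 3), (mfderiv 𝓘(ℝ, EuclideanSpace ℝ (Fin 3)) (𝓡 3)
      (extChartAt (𝓡 3) x).symm (extChartAt (𝓡 3) x x) :
        EuclideanSpace ℝ (Fin 3) →L[ℝ] EuclideanSpace ℝ (Fin 3)) w = w :=
    fun w ↦ by rw [key]; rfl
  have h2 : ∀ z : M, z = x → (h z : EuclideanSpace ℝ (Fin 3) →L[ℝ]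
      EuclideanSpace ℝ (Fin 3) →L[ℝ] ℝ) u v = h x u v := by
    rintro z rfl
    rfl
  refine Eq.trans ?_ (h2 _ (extChartAt_to_inv (I := 𝓡 3) x))
  exact congrArg₂ (fun a b ↦ (h ((extChartAt (𝓡 3) x).symm (extChartAt (𝓡 3) x x)) :
    EuclideanSpace ℝ (Fin 3) →L[ℝ] EuclideanSpace ℝ (Fin 3) →L[ℝ] ℝ) a b) (hu u) (hu v)

/-- The curvature tensor `R_{u,v} w` at `x` of a field `h` of scalar products. -/
def curvatureTensor
    (h : ∀ x : M, TangentSpace (𝓡 3) x →L[ℝ] TangentSpace (𝓡 3) x →L[ℝ] ℝ) (x : M) :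
    TangentSpace (𝓡 3) x →L[ℝ] TangentSpace (𝓡 3) x →L[ℝ]
      TangentSpace (𝓡 3) x →L[ℝ] TangentSpace (𝓡 3) x :=
  riemann (inChart h x) (extChartAt (𝓡 3) x x)

/-- The Cotton form at `x` of a field `h` of scalar products. -/
def cottonFormAt
    (h : ∀ x : M, TangentSpace (𝓡 3) x →L[ℝ] TangentSpace (𝓡 3) x →L[ℝ] ℝ) (x : M) :
    TangentSpace (𝓡 3) x →L[ℝ] TangentSpace (𝓡 3) x →L[ℝ] TangentSpace (𝓡 3) x :=
  cottonForm (inChart h x) (extChartAt (𝓡 3) x x)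

variable [IsManifold (𝓡 3) ∞ M]

/-- A smooth Riemannian metric on a 3-manifold. -/
abbrev Metric (M : Type*) [TopologicalSpace M] [ChartedSpace (EuclideanSpace ℝ (Fin 3)) M]
    [IsManifold (𝓡 3) ∞ M] :=
  Bundle.ContMDiffRiemannianMetric (𝓡 3) ∞ (EuclideanSpace ℝ (Fin 3))
    (fun x : M ↦ TangentSpace (𝓡 3) x)

theorem exists_orientedOrthonormalFrame (g : Metric M) (x : M)
    (o : Orientation ℝ (TangentSpace (𝓡 3) x) (Fin 3)) :
    ∃ S : Module.Basis (Fin 3) ℝ (TangentSpace (𝓡 3) x),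
      S.orientation = o ∧ ∀ i j, g.inner x (S i) (S j) = if i = j then 1 else 0 := by
  let c := g.toRiemannianMetric.toCore x
  let _ : NormedAddCommGroup (TangentSpace (𝓡 3) x) := c.toNormedAddCommGroup
  let _ : InnerProductSpace ℝ (TangentSpace (𝓡 3) x) := InnerProductSpace.ofCore c.toCore
  have hd : Module.finrank ℝ (TangentSpace (𝓡 3) x) = 3 :=
    finrank_euclideanSpace_fin (𝕜 := ℝ) (n := 3)
  let b := o.finOrthonormalBasis (by norm_num) hd
  refine ⟨b.toBasis, o.finOrthonormalBasis_orientation (by norm_num) hd, fun i j ↦ ?_⟩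
  have h := orthonormal_iff_ite.mp b.orthonormal i j
  simpa using! h

/-- An oriented `g`-orthonormal basis `S₀, S₁, S₂` of the tangent space at `x`. -/
def orientedOrthonormalFrame (g : Metric M) (x : M)
    (o : Orientation ℝ (TangentSpace (𝓡 3) x) (Fin 3)) :
    Module.Basis (Fin 3) ℝ (TangentSpace (𝓡 3) x) :=
  (exists_orientedOrthonormalFrame g x o).choose

/-- The Hodge star from vector-valued `2`-forms to vector-valued `1`-forms at `x`, determined by
`*(S¹ ∧ S²) = S⁰`, `*(S² ∧ S⁰) = S¹`, `*(S⁰ ∧ S¹) = S²`: for a `2`-form `α`,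
`*α = ∑ i, α(S (i + 1), S (i + 2)) Sⁱ`, indices modulo `3`. -/
def hodgeStar (g : Metric M) (x : M) (o : Orientation ℝ (TangentSpace (𝓡 3) x) (Fin 3))
    (α : TangentSpace (𝓡 3) x →L[ℝ] TangentSpace (𝓡 3) x →L[ℝ] TangentSpace (𝓡 3) x) :
    TangentSpace (𝓡 3) x →ₗ[ℝ] TangentSpace (𝓡 3) x :=
  ∑ i : Fin 3, ((orientedOrthonormalFrame g x o).coord i).smulRight
    (α (orientedOrthonormalFrame g x o (i + 1)) (orientedOrthonormalFrame g x o (i + 2)))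

/-- The Cotton tensor `Cott = * d^∇ Sch` of `g` at `x`, with respect to an orientation of the
tangent space at `x`, as a bilinear form. -/
def cottonTensor (g : Metric M) (x : M) (o : Orientation ℝ (TangentSpace (𝓡 3) x) (Fin 3)) :
    LinearMap.BilinForm ℝ (TangentSpace (𝓡 3) x) :=
  (ContinuousLinearMap.coeLM ℝ).comp
    ((g.inner x).toLinearMap.comp (hodgeStar g x o (cottonFormAt g.inner x)))

theorem cottonTensor_apply (g : Metric M) (x : M)
    (o : Orientation ℝ (TangentSpace (𝓡 3) x) (Fin 3)) (u v : TangentSpace (𝓡 3) x) :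
    cottonTensor g x o u v = g.inner x (hodgeStar g x o (cottonFormAt g.inner x) u) v :=
  rfl

/-- `g` is locally conformally flat: near every point there is a smooth function `f` such that
`e^{2f} g` is flat, i.e. has vanishing curvature. -/
def LocallyConformallyFlat (g : Metric M) : Prop :=
  ∀ x : M, ∃ (V : Set M) (f : M → ℝ), IsOpen V ∧ x ∈ V ∧ ContMDiffOn (𝓡 3) 𝓘(ℝ, ℝ) ∞ f V ∧
    ∀ y ∈ V, curvatureTensor (fun z ↦ Real.exp (2 * f z) • g.inner z) y = 0

end Manifold

end CottonGeometry

end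

/-! Let `X` be the gradient of `f` and put S = ∇X - X♭⊗X + ½|X|² id. The curvature of e^{2f}g is the
curvature of g minus the Kulkarni–Nomizu product of g and S (`IsMetricOn.riemann_conformal`). In
dimension three a curvature tensor is determined by its Ricci trace, so the curvature of g is itself
the Kulkarni–Nomizu product of g and the Schouten tensor (`IsMetricOn.riemann_eq_kulkarniNomizu`),
and S can be recovered from that product (`IsMetricOn.schoutenSharp_eq_of_riemann_eq`). Hence
e^{2f}g is flat exactly when S = Sch♯, that is, when the gradient satisfies ∇X = Sch♯ + X♭⊗X - ½|X|²
id.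

This is a total differential equation for `X`: every partial derivative is prescribed
(`flatteningSystem`). The antisymmetrised cross derivatives of its right-hand side contain a
curvature term R(u,v)X. Once the curvature is expressed by the Schouten tensor, every term involving
`X` cancels and the obstruction is exactly the Cotton form
(`IsMetricOn.fderiv_flatteningSystem_sub`). If a flattening f exists, second derivatives of its
gradient commute, so the Cotton form vanishes. Conversely, if the Cotton form vanishes, Frobenius'
theorem (`exists_hasFDerivAt_of_integrable`) solves the system locally. The solution has symmetric
∇X because Sch is symmetric, so a second application of Frobenius' theorem gives f with gradient
`X`.

All this takes place in one chart, whereas the tensors at a point p are defined in the preferred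
chart at p. Naturality under local diffeomorphisms (`fderiv_riemann_pullback`,
`fderiv_cottonForm_pullback`) connects the two. The choice of orientations is harmless, since the
Hodge star is injective on 2-forms for either orientation (`hodgeStar_eq_zero_iff`). -/

open scoped Topology

namespace CottonGeometry

/-! ### Product rules for fields of multilinear maps. -/

section Calculus

variable {E F₁ F₂ F₃ F₄ : Type*} [NormedAddCommGroup E] [NormedSpace ℝ E]
  [NormedAddCommGroup F₁] [NormedSpace ℝ F₁] [NormedAddCommGroup F₂] [NormedSpace ℝ F₂]
  [NormedAddCommGroup F₃] [NormedSpace ℝ F₃] [NormedAddCommGroup F₄] [NormedSpace ℝ F₄]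

theorem fderiv_clm_apply₁ {L : E → F₁ →L[ℝ] F₂} {a : E → F₁} {y : E}
    (hL : DifferentiableAt ℝ L y) (ha : DifferentiableAt ℝ a y) (w : E) :
    fderiv ℝ (fun z ↦ L z (a z)) y w = fderiv ℝ L y w (a y) + L y (fderiv ℝ a y w) := by
  rw [fderiv_clm_apply hL ha]
  simp [add_comm]

theorem fderiv_clm_apply₂ {L : E → F₁ →L[ℝ] F₂ →L[ℝ] F₃} {a : E → F₁} {b : E → F₂} {y : E}
    (hL : DifferentiableAt ℝ L y) (ha : DifferentiableAt ℝ a y) (hb : DifferentiableAt ℝ b y)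
    (w : E) :
    fderiv ℝ (fun z ↦ L z (a z) (b z)) y w =
      fderiv ℝ L y w (a y) (b y) + L y (fderiv ℝ a y w) (b y) + L y (a y) (fderiv ℝ b y w) := by
  rw [fderiv_clm_apply₁ (hL.clm_apply ha) hb, fderiv_clm_apply₁ hL ha]
  simp

theorem fderiv_clm_apply_const₁ {L : E → F₁ →L[ℝ] F₂} {y : E}
    (hL : DifferentiableAt ℝ L y) (a : F₁) (w : E) :
    fderiv ℝ (fun z ↦ L z a) y w = fderiv ℝ L y w a := by
  rw [fderiv_clm_apply₁ hL (differentiableAt_const a)]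
  simp

theorem fderiv_clm_apply_const₂ {L : E → F₁ →L[ℝ] F₂ →L[ℝ] F₃} {y : E}
    (hL : DifferentiableAt ℝ L y) (a : F₁) (b : F₂) (w : E) :
    fderiv ℝ (fun z ↦ L z a b) y w = fderiv ℝ L y w a b := by
  rw [fderiv_clm_apply₂ hL (differentiableAt_const a) (differentiableAt_const b)]
  simp

theorem fderiv_fderiv_apply_comm {f : E → F₁} {y : E} (hf : ContDiffAt ℝ ∞ f y) (u v : E) :
    fderiv ℝ (fderiv ℝ f) y u v = fderiv ℝ (fderiv ℝ f) y v u :=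
  (hf.isSymmSndFDerivAt (by simpa using ENat.LEInfty.out)).eq u v

theorem contDiffOn_fderiv {T : E → F₁} {U : Set E} (hU : IsOpen U) (hT : ContDiffOn ℝ ∞ T U) :
    ContDiffOn ℝ ∞ (fderiv ℝ T) U :=
  hT.fderiv_of_isOpen hU (by simp)

end Calculus

/-! ### Metrics in coordinates: the Levi-Civita connection and smoothness of the curvature
quantities. -/

/-- `G` is a smooth Riemannian metric, in coordinates, on the open set `U`. -/
structure IsMetricOn {E : Type*} [NormedAddCommGroup E] [NormedSpace ℝ E]
    (G : E → E →L[ℝ] E →L[ℝ] ℝ) (U : Set E) : Prop where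
  isOpen : IsOpen U
  contDiffOn : ContDiffOn ℝ ∞ G U
  symm : ∀ y ∈ U, ∀ u v, G y u v = G y v u
  pos : ∀ y ∈ U, ∀ u, u ≠ 0 → 0 < G y u u

namespace IsMetricOn

variable {E : Type*} [NormedAddCommGroup E] [NormedSpace ℝ E] {G : E → E →L[ℝ] E →L[ℝ] ℝ}
  {U V : Set E} {y : E}

theorem mono (h : IsMetricOn G U) (hV : IsOpen V) (hVU : V ⊆ U) : IsMetricOn G V :=
  ⟨hV, h.contDiffOn.mono hVU, fun y hy ↦ h.symm y (hVU hy), fun y hy ↦ h.pos y (hVU hy)⟩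

theorem eq_of_forall_apply_eq (h : IsMetricOn G U) (hy : y ∈ U) {a b : E}
    (hab : ∀ z, G y a z = G y b z) : a = b := by
  by_contra hne
  have h1 := h.pos y hy (a - b) (sub_ne_zero.mpr hne)
  rw [map_sub (G y) a b, sub_apply, hab, sub_self] at h1
  exact lt_irrefl _ h1

theorem contDiffAt (h : IsMetricOn G U) (hy : y ∈ U) : ContDiffAt ℝ ∞ G y :=
  h.contDiffOn.contDiffAt (h.isOpen.mem_nhds hy)

theorem differentiableAt (h : IsMetricOn G U) (hy : y ∈ U) : DifferentiableAt ℝ G y :=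
  (h.contDiffAt hy).differentiableAt (by simp)

theorem fderiv_symm (h : IsMetricOn G U) (hy : y ∈ U) (w u v : E) :
    fderiv ℝ G y w u v = fderiv ℝ G y w v u := by
  rw [← fderiv_clm_apply_const₂ (h.differentiableAt hy),
    ← fderiv_clm_apply_const₂ (h.differentiableAt hy)]
  have : (fun z ↦ G z u v) =ᶠ[𝓝 y] fun z ↦ G z v u := by
    filter_upwards [h.isOpen.mem_nhds hy] with z hz using h.symm z hz u v
  rw [this.fderiv_eq]

variable [FiniteDimensional ℝ E]

/-- Positivity gives injectivity, and `E` and its dual have the same dimension. Since `sharp` is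
`ContinuousLinearMap.inverse`, which is zero on non-invertible maps, this is what gives index
raising its meaning. -/
theorem isInvertible (h : IsMetricOn G U) (hy : y ∈ U) : (G y).IsInvertible := by
  have hinj : Function.Injective (G y : E →ₗ[ℝ] (E →L[ℝ] ℝ)) := fun a b hab ↦
    h.eq_of_forall_apply_eq hy fun z ↦ congrArg (fun φ : E →L[ℝ] ℝ ↦ φ z) hab
  have hd : Module.finrank ℝ E = Module.finrank ℝ (E →L[ℝ] ℝ) := by
    rw [← (LinearMap.toContinuousLinearMap (𝕜 := ℝ) (E := E) (F' := ℝ)).finrank_eq]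
    exact (Subspace.dual_finrank_eq (K := ℝ) (V := E)).symm
  refine ⟨(LinearEquiv.ofInjectiveOfFinrankEq _ hinj hd).toContinuousLinearEquiv, ?_⟩
  ext a b
  rfl

theorem apply_sharp (h : IsMetricOn G U) (hy : y ∈ U) (φ : E →L[ℝ] ℝ) :
    G y (sharp G y φ) = φ :=
  (h.isInvertible hy).self_apply_inverse φ

theorem sharp_eq_of_forall (h : IsMetricOn G U) (hy : y ∈ U) {φ : E →L[ℝ] ℝ} {a : E}
    (ha : ∀ z, G y a z = φ z) : sharp G y φ = a :=
  h.eq_of_forall_apply_eq hy fun z ↦ by rw [h.apply_sharp hy, ha]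

theorem apply_christoffel (h : IsMetricOn G U) (hy : y ∈ U) (u v z : E) :
    G y (christoffel G y u v) z =
      (1 / 2 : ℝ) * (fderiv ℝ G y u v z + fderiv ℝ G y v u z - fderiv ℝ G y z u v) := by
  rw [christoffel_apply, h.apply_sharp hy, christoffelFirst_apply]

theorem christoffel_symm (h : IsMetricOn G U) (hy : y ∈ U) (u v : E) :
    christoffel G y u v = christoffel G y v u := by
  refine h.eq_of_forall_apply_eq hy fun z ↦ ?_
  rw [h.apply_christoffel hy, h.apply_christoffel hy, h.fderiv_symm hy z u v]
  ring

/-- The Levi-Civita connection is compatible with the metric. -/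
theorem fderiv_eq (h : IsMetricOn G U) (hy : y ∈ U) (w u v : E) :
    fderiv ℝ G y w u v = G y (christoffel G y w u) v + G y u (christoffel G y w v) := by
  rw [h.symm y hy u, h.apply_christoffel hy, h.apply_christoffel hy, h.fderiv_symm hy w v u,
    h.fderiv_symm hy u w v, h.fderiv_symm hy v w u]
  ring

/-- Uniqueness of the Levi-Civita connection. -/
theorem christoffel_eq_of (h : IsMetricOn G U) (hy : y ∈ U) {C : E → E → E}
    (hC : ∀ u v, C u v = C v u)
    (hG : ∀ w u v, fderiv ℝ G y w u v = G y (C w u) v + G y u (C w v)) (u v : E) :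
    christoffel G y u v = C u v := by
  refine h.eq_of_forall_apply_eq hy fun z ↦ ?_
  rw [h.apply_christoffel hy, hG, hG, hG, h.symm y hy u (C z v), h.symm y hy v (C u z),
    h.symm y hy u (C v z), hC z u, hC z v, hC v u]
  ring

theorem contDiffOn_sharp (h : IsMetricOn G U) : ContDiffOn ℝ ∞ (sharp G) U := fun _ hy ↦
  ((h.isInvertible hy).contDiffAt_map_inverse.comp _ (h.contDiffAt hy)).contDiffWithinAt

theorem contDiffOn_christoffel (h : IsMetricOn G U) : ContDiffOn ℝ ∞ (christoffel G) U := by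
  simp only [contDiffOn_clm_apply, christoffel_apply, christoffelFirst]
  intro u v
  refine h.contDiffOn_sharp.clm_apply ?_
  have h1 := contDiffOn_fderiv h.isOpen h.contDiffOn
  simp only [contDiffOn_clm_apply] at h1 ⊢
  intro z
  exact contDiffOn_const.mul (((h1 u v z).add (h1 v u z)).sub (h1 z u v))

theorem contDiffOn_riemann (h : IsMetricOn G U) : ContDiffOn ℝ ∞ (riemann G) U := by
  have h1 := h.contDiffOn_christoffel
  have h2 := contDiffOn_fderiv h.isOpen h1
  simp only [contDiffOn_clm_apply, riemann_apply, secondDerivative_apply]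
  intro u v w
  have h3 : ∀ u v w, ContDiffOn ℝ ∞
      (fun y ↦ fderiv ℝ (christoffel G) y u v w + christoffel G y u (christoffel G y v w)) U :=
    fun u v w ↦ (((h2.clm_apply contDiffOn_const).clm_apply contDiffOn_const).clm_apply
      contDiffOn_const).add ((h1.clm_apply contDiffOn_const).clm_apply
        ((h1.clm_apply contDiffOn_const).clm_apply contDiffOn_const))
  exact (h3 u v w).sub (h3 v u w)

theorem contDiffOn_ricci (h : IsMetricOn G U) : ContDiffOn ℝ ∞ (ricci G) U := by
  simp only [contDiffOn_clm_apply]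
  intro u v
  have h1 : ContDiffOn ℝ ∞ (fun y ↦ swapLast (riemann G y).flip u v) U := by
    rw [contDiffOn_clm_apply]
    intro w
    change ContDiffOn ℝ ∞ (fun y ↦ riemann G y w u v) U
    exact ((h.contDiffOn_riemann.clm_apply contDiffOn_const).clm_apply
      contDiffOn_const).clm_apply contDiffOn_const
  have h2 : ∀ y, ricci G y u v = traceCLM E (swapLast (riemann G y).flip u v) := fun _ ↦ rfl
  simp only [h2]
  exact (traceCLM E).contDiff.comp_contDiffOn h1

theorem contDiffOn_schoutenSharp (h : IsMetricOn G U) :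
    ContDiffOn ℝ ∞ (schoutenSharp G) U := by
  have h1 : ContDiffOn ℝ ∞ (scal G) U :=
    (traceCLM E).contDiff.comp_contDiffOn (h.contDiffOn_sharp.clm_comp h.contDiffOn_ricci)
  exact h.contDiffOn_sharp.clm_comp
    (h.contDiffOn_ricci.sub ((h1.div_const _).smul h.contDiffOn))

theorem differentiableAt_christoffel (h : IsMetricOn G U) (hy : y ∈ U) :
    DifferentiableAt ℝ (christoffel G) y :=
  (h.contDiffOn_christoffel.contDiffAt (h.isOpen.mem_nhds hy)).differentiableAt (by simp)

theorem differentiableAt_schoutenSharp (h : IsMetricOn G U) (hy : y ∈ U) :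
    DifferentiableAt ℝ (schoutenSharp G) y :=
  (h.contDiffOn_schoutenSharp.contDiffAt (h.isOpen.mem_nhds hy)).differentiableAt (by simp)

end IsMetricOn

end CottonGeometry

namespace CottonGeometry

/-! ### Naturality under local diffeomorphisms. -/

section Naturality

variable {E : Type*} [NormedAddCommGroup E] [NormedSpace ℝ E]

/-- The pull-back of a field of bilinear forms under `F`. -/
noncomputable def pullback (F : E → E) (G : E → E →L[ℝ] E →L[ℝ] ℝ) (y : E) : E →L[ℝ] E →L[ℝ] ℝ :=
  (G (F y)).bilinearComp (fderiv ℝ F y) (fderiv ℝ F y)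

theorem pullback_apply (F : E → E) (G : E → E →L[ℝ] E →L[ℝ] ℝ) (y u v : E) :
    pullback F G y u v = G (F y) (fderiv ℝ F y u) (fderiv ℝ F y v) :=
  rfl

/-- `F` is a smooth local diffeomorphism from the open set `W` to `U`. -/
structure IsLocalDiffeoOn (F : E → E) (W U : Set E) : Prop where
  isOpen : IsOpen W
  contDiffOn : ContDiffOn ℝ ∞ F W
  mapsTo : ∀ y ∈ W, F y ∈ U
  isInvertible : ∀ y ∈ W, (fderiv ℝ F y).IsInvertible

variable {F : E → E} {G : E → E →L[ℝ] E →L[ℝ] ℝ} {U W : Set E} {y : E}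

theorem IsLocalDiffeoOn.differentiableAt (hF : IsLocalDiffeoOn F W U) (hy : y ∈ W) :
    DifferentiableAt ℝ F y :=
  (hF.contDiffOn.contDiffAt (hF.isOpen.mem_nhds hy)).differentiableAt (by simp)

theorem IsLocalDiffeoOn.differentiableAt_fderiv (hF : IsLocalDiffeoOn F W U) (hy : y ∈ W) :
    DifferentiableAt ℝ (fderiv ℝ F) y :=
  ((contDiffOn_fderiv hF.isOpen hF.contDiffOn).contDiffAt
    (hF.isOpen.mem_nhds hy)).differentiableAt (by simp)

theorem IsLocalDiffeoOn.differentiableAt_fderiv_fderiv (hF : IsLocalDiffeoOn F W U)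
    (hy : y ∈ W) : DifferentiableAt ℝ (fderiv ℝ (fderiv ℝ F)) y :=
  ((contDiffOn_fderiv hF.isOpen (contDiffOn_fderiv hF.isOpen hF.contDiffOn)).contDiffAt
    (hF.isOpen.mem_nhds hy)).differentiableAt (by simp)

theorem fderiv_comp_apply' {F₁ F₂ : Type*} [NormedAddCommGroup F₁]
    [NormedSpace ℝ F₁] [NormedAddCommGroup F₂] [NormedSpace ℝ F₂] {T : F₁ → F₂} {f : E → F₁} {y : E}
    (hT : DifferentiableAt ℝ T (f y)) (hf : DifferentiableAt ℝ f y) (w : E) :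
    fderiv ℝ (fun z ↦ T (f z)) y w = fderiv ℝ T (f y) (fderiv ℝ f y w) := by
  rw [fderiv_fun_comp y hT hf]
  rfl

variable [FiniteDimensional ℝ E]

theorem IsMetricOn.pullback (hG : IsMetricOn G U) (hF : IsLocalDiffeoOn F W U) :
    IsMetricOn (pullback F G) W where
  isOpen := hF.isOpen
  contDiffOn := by
    have h1 : ContDiffOn ℝ ∞ (fun z ↦ G (F z)) W := hG.contDiffOn.comp hF.contDiffOn hF.mapsTo
    have h2 := contDiffOn_fderiv hF.isOpen hF.contDiffOn
    simp only [contDiffOn_clm_apply, pullback_apply]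
    intro u v
    exact (h1.clm_apply (h2.clm_apply contDiffOn_const)).clm_apply (h2.clm_apply contDiffOn_const)
  symm y hy u v := hG.symm _ (hF.mapsTo y hy) _ _
  pos y hy u hu := hG.pos _ (hF.mapsTo y hy) _ fun h ↦
    hu ((hF.isInvertible y hy).injective (h.trans (map_zero _).symm))

/-- The second derivative of `F` is the usual inhomogeneous term. Applying the inverse of DF to the
right-hand side gives an expression that is symmetric in `u`, `v` and compatible with the
pulled-back metric, so uniqueness of the Levi-Civita connection identifies it. -/
theorem fderiv_christoffel_pullback (hG : IsMetricOn G U) (hF : IsLocalDiffeoOn F W U)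
    (hy : y ∈ W) (u v : E) :
    fderiv ℝ F y (christoffel (pullback F G) y u v) =
      christoffel G (F y) (fderiv ℝ F y u) (fderiv ℝ F y v) +
        fderiv ℝ (fderiv ℝ F) y u v := by
  have hH := hG.pullback hF
  have hFy := hF.mapsTo y hy
  have hsymm := fderiv_fderiv_apply_comm (hF.contDiffOn.contDiffAt (hF.isOpen.mem_nhds hy))
  have hinv := hF.isInvertible y hy
  have hG1 : DifferentiableAt ℝ (fun z ↦ G (F z)) y :=
    (hG.differentiableAt hFy).comp y (hF.differentiableAt hy)
  have hA := hF.differentiableAt_fderiv hy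
  rw [hH.christoffel_eq_of hy (C := fun u v ↦ (fderiv ℝ F y).inverse
    (christoffel G (F y) (fderiv ℝ F y u) (fderiv ℝ F y v) + fderiv ℝ (fderiv ℝ F) y u v)),
    hinv.self_apply_inverse]
  · intro u v
    rw [hG.christoffel_symm hFy, hsymm]
  · intro w u v
    rw [← fderiv_clm_apply_const₂ (hH.differentiableAt hy)]
    simp only [pullback_apply]
    rw [fderiv_clm_apply₂ hG1 (hA.clm_apply (differentiableAt_const u))
      (hA.clm_apply (differentiableAt_const v)), fderiv_clm_apply_const₁ hA,
      fderiv_clm_apply_const₁ hA, fderiv_comp_apply' (hG.differentiableAt hFy)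
      (hF.differentiableAt hy), hG.fderiv_eq hFy, hinv.self_apply_inverse,
      hinv.self_apply_inverse]
    simp only [map_add, add_apply]
    ring

/-- Differentiating the transformation law of the Christoffel symbols produces second and third
derivatives of `F`. By their symmetry and that of the Christoffel symbols, they drop out on
antisymmetrising in `u` and `v`. -/
theorem fderiv_riemann_pullback (hG : IsMetricOn G U) (hF : IsLocalDiffeoOn F W U)
    (hy : y ∈ W) (u v w : E) :
    fderiv ℝ F y (riemann (pullback F G) y u v w) =
      riemann G (F y) (fderiv ℝ F y u) (fderiv ℝ F y v) (fderiv ℝ F y w) := by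
  have hH := hG.pullback hF
  have hFy := hF.mapsTo y hy
  have hA := hF.differentiableAt_fderiv hy
  have hAA := hF.differentiableAt_fderiv_fderiv hy
  have hΓ : DifferentiableAt ℝ (fun z ↦ christoffel G (F z)) y :=
    (hG.differentiableAt_christoffel hFy).comp y (hF.differentiableAt hy)
  have hΓH := hH.differentiableAt_christoffel hy
  have hnhds := hF.isOpen.mem_nhds hy
  have hsymm := fderiv_fderiv_apply_comm (hF.contDiffOn.contDiffAt hnhds)
  have hsymm3 := fderiv_fderiv_apply_comm
    ((contDiffOn_fderiv hF.isOpen hF.contDiffOn).contDiffAt hnhds)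
  have key : ∀ u v w, fderiv ℝ F y (fderiv ℝ (christoffel (pullback F G)) y u v w) =
      fderiv ℝ (christoffel G) (F y) (fderiv ℝ F y u) (fderiv ℝ F y v) (fderiv ℝ F y w)
      + christoffel G (F y) (fderiv ℝ (fderiv ℝ F) y u v) (fderiv ℝ F y w)
      + christoffel G (F y) (fderiv ℝ F y v) (fderiv ℝ (fderiv ℝ F) y u w)
      + fderiv ℝ (fderiv ℝ (fderiv ℝ F)) y u v w
      - fderiv ℝ (fderiv ℝ F) y u (christoffel (pullback F G) y v w) := by
    intro u v w
    have h1 : (fun z ↦ fderiv ℝ F z (christoffel (pullback F G) z v w)) =ᶠ[𝓝 y] fun z ↦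
        christoffel G (F z) (fderiv ℝ F z v) (fderiv ℝ F z w) + fderiv ℝ (fderiv ℝ F) z v w := by
      filter_upwards [hnhds] with z hz using fderiv_christoffel_pullback hG hF hz v w
    have h2 := DFunLike.congr_fun (h1.fderiv_eq (𝕜 := ℝ)) u
    rw [fderiv_clm_apply₁ hA ((hΓH.clm_apply (differentiableAt_const v)).clm_apply
      (differentiableAt_const w)), fderiv_clm_apply_const₂ hΓH,
      fderiv_fun_add ((hΓ.clm_apply (hA.clm_apply (differentiableAt_const v))).clm_apply
        (hA.clm_apply (differentiableAt_const w)))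
        ((hAA.clm_apply (differentiableAt_const v)).clm_apply (differentiableAt_const w)),
      add_apply, fderiv_clm_apply_const₂ hAA,
      fderiv_clm_apply₂ hΓ (hA.clm_apply (differentiableAt_const v))
        (hA.clm_apply (differentiableAt_const w)), fderiv_clm_apply_const₁ hA,
      fderiv_clm_apply_const₁ hA, fderiv_comp_apply' (hG.differentiableAt_christoffel hFy)
        (hF.differentiableAt hy)] at h2
    rw [eq_sub_iff_add_eq, add_comm, h2]
  simp only [riemann_apply, secondDerivative_apply, map_sub, map_add, key,
    fderiv_christoffel_pullback hG hF hy]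
  rw [hsymm v u, hsymm3 v u, hG.christoffel_symm hFy (fderiv ℝ F y v) (fderiv ℝ (fderiv ℝ F) y u w)]
  rw [hG.christoffel_symm hFy (fderiv ℝ F y u) (fderiv ℝ (fderiv ℝ F) y v w)]
  abel

theorem fderiv_sharp_pullback (hG : IsMetricOn G U) (hF : IsLocalDiffeoOn F W U)
    (hy : y ∈ W) {φ ψ : E →L[ℝ] ℝ} (h : ∀ z, φ z = ψ (fderiv ℝ F y z)) :
    fderiv ℝ F y (sharp (pullback F G) y φ) = sharp G (F y) ψ := by
  symm
  apply hG.sharp_eq_of_forall (hF.mapsTo y hy)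
  intro z
  obtain ⟨z, rfl⟩ := (hF.isInvertible y hy).surjective z
  rw [← h, ← pullback_apply, (hG.pullback hF).apply_sharp hy]

theorem trace_eq_of_isInvertible_comm {A T S : E →L[ℝ] E} (hA : A.IsInvertible)
    (h : ∀ z, A (T z) = S (A z)) : traceCLM E T = traceCLM E S := by
  obtain ⟨e, rfl⟩ := hA
  have : (S : E →ₗ[ℝ] E) = e.toLinearEquiv.conj (T : E →ₗ[ℝ] E) := by
    ext z
    have := h (e.symm z)
    simp at this
    simp [LinearEquiv.conj_apply, this]
  change LinearMap.trace ℝ E (T : E →ₗ[ℝ] E) = LinearMap.trace ℝ E (S : E →ₗ[ℝ] E)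
  rw [this, LinearMap.trace_conj']

theorem ricci_pullback (hG : IsMetricOn G U) (hF : IsLocalDiffeoOn F W U) (hy : y ∈ W)
    (u v : E) : ricci (pullback F G) y u v =
      ricci G (F y) (fderiv ℝ F y u) (fderiv ℝ F y v) :=
  trace_eq_of_isInvertible_comm (T := swapLast (riemann (pullback F G) y).flip u v)
    (S := swapLast (riemann G (F y)).flip (fderiv ℝ F y u) (fderiv ℝ F y v))
    (hF.isInvertible y hy) fun z ↦ fderiv_riemann_pullback hG hF hy z u v

theorem scal_pullback (hG : IsMetricOn G U) (hF : IsLocalDiffeoOn F W U) (hy : y ∈ W) :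
    scal (pullback F G) y = scal G (F y) :=
  trace_eq_of_isInvertible_comm (hF.isInvertible y hy) fun z ↦
    fderiv_sharp_pullback hG hF hy fun v ↦ ricci_pullback hG hF hy z v

theorem schouten_apply (G : E → E →L[ℝ] E →L[ℝ] ℝ) (y u v : E) :
    schouten G y u v = ricci G y u v - scal G y / 4 * G y u v :=
  rfl

theorem fderiv_schoutenSharp_pullback (hG : IsMetricOn G U) (hF : IsLocalDiffeoOn F W U)
    (hy : y ∈ W) (v : E) :
    fderiv ℝ F y (schoutenSharp (pullback F G) y v) = schoutenSharp G (F y) (fderiv ℝ F y v) := by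
  refine fderiv_sharp_pullback hG hF hy fun z ↦ ?_
  change schouten (pullback F G) y v z = schouten G (F y) (fderiv ℝ F y v) (fderiv ℝ F y z)
  rw [schouten_apply, schouten_apply, ricci_pullback hG hF hy, scal_pullback hG hF hy,
    pullback_apply]

/-- Same scheme, now differentiating the transformation law of Sch♯. One second-derivative term
cancels against the inhomogeneous term of the Christoffel symbols, the other by symmetry in `u` and
`v`. -/
theorem fderiv_cottonForm_pullback (hG : IsMetricOn G U) (hF : IsLocalDiffeoOn F W U)
    (hy : y ∈ W) (u v : E) :
    fderiv ℝ F y (cottonForm (pullback F G) y u v) =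
      cottonForm G (F y) (fderiv ℝ F y u) (fderiv ℝ F y v) := by
  have hH := hG.pullback hF
  have hFy := hF.mapsTo y hy
  have hA := hF.differentiableAt_fderiv hy
  have hS : DifferentiableAt ℝ (fun z ↦ schoutenSharp G (F z)) y :=
    (hG.differentiableAt_schoutenSharp hFy).comp y (hF.differentiableAt hy)
  have hSH := hH.differentiableAt_schoutenSharp hy
  have hnhds := hF.isOpen.mem_nhds hy
  have hsymm := fderiv_fderiv_apply_comm (hF.contDiffOn.contDiffAt hnhds)
  have key : ∀ u v, fderiv ℝ F y (fderiv ℝ (schoutenSharp (pullback F G)) y u v) =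
      fderiv ℝ (schoutenSharp G) (F y) (fderiv ℝ F y u) (fderiv ℝ F y v)
      + schoutenSharp G (F y) (fderiv ℝ (fderiv ℝ F) y u v)
      - fderiv ℝ (fderiv ℝ F) y u (schoutenSharp (pullback F G) y v) := by
    intro u v
    have h1 : (fun z ↦ fderiv ℝ F z (schoutenSharp (pullback F G) z v)) =ᶠ[𝓝 y] fun z ↦
        schoutenSharp G (F z) (fderiv ℝ F z v) := by
      filter_upwards [hnhds] with z hz using fderiv_schoutenSharp_pullback hG hF hz v
    have h2 := DFunLike.congr_fun (h1.fderiv_eq (𝕜 := ℝ)) u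
    rw [fderiv_clm_apply₁ hA (hSH.clm_apply (differentiableAt_const v)),
      fderiv_clm_apply_const₁ hSH, fderiv_clm_apply₁ hS (hA.clm_apply (differentiableAt_const v)),
      fderiv_clm_apply_const₁ hA, fderiv_comp_apply' (hG.differentiableAt_schoutenSharp hFy)
        (hF.differentiableAt hy)] at h2
    rw [eq_sub_iff_add_eq, add_comm, h2]
  simp only [cottonForm_apply, schoutenDerivative_apply, map_sub, map_add, key,
    fderiv_christoffel_pullback hG hF hy, fderiv_schoutenSharp_pullback hG hF hy]
  rw [hsymm v u]
  abel

end Naturality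

end CottonGeometry

namespace CottonGeometry

/-! ### Algebra of curvature tensors in dimension three. -/

section Algebra

variable {E : Type*} [NormedAddCommGroup E] [NormedSpace ℝ E]

/-- The Kulkarni–Nomizu product of a scalar product `g` and the bilinear form `g (S u) v`, as a
curvature tensor. -/
noncomputable def kulkarniNomizu (g : E →L[ℝ] E →L[ℝ] ℝ) (S : E →L[ℝ] E) :
    E →L[ℝ] E →L[ℝ] E →L[ℝ] E :=
  let T₁ := (ContinuousLinearMap.smulRightL ℝ E E).bilinearComp (g.comp S)
    (ContinuousLinearMap.id ℝ E)
  let T₂ := (ContinuousLinearMap.smulRightL ℝ E E).bilinearComp g S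
  T₁.flip - T₁ + (T₂.flip - T₂)

theorem kulkarniNomizu_apply (g : E →L[ℝ] E →L[ℝ] ℝ) (S : E →L[ℝ] E) (u v w : E) :
    kulkarniNomizu g S u v w = g (S v) w • u - g (S u) w • v + (g v w • S u - g u w • S v) :=
  rfl

theorem clm_ext_basis {ι F : Type*} [NormedAddCommGroup F] [NormedSpace ℝ F]
    (b : Module.Basis ι ℝ E) {f g : E →L[ℝ] F} (h : ∀ i, f (b i) = g (b i)) : f = g :=
  ContinuousLinearMap.coe_injective (b.ext h)

theorem IsMetricOn.exists_orthonormalBasis {G : E → E →L[ℝ] E →L[ℝ] ℝ} {U : Set E} {y : E}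
    (h : IsMetricOn G U) (hy : y ∈ U) (hE : Module.finrank ℝ E = 3) :
    ∃ b : Module.Basis (Fin 3) ℝ E, ∀ i j, G y (b i) (b j) = if i = j then 1 else 0 := by
  let B : LinearMap.BilinForm ℝ E := (ContinuousLinearMap.coeLM ℝ).comp (G y).toLinearMap
  let c : InnerProductSpace.Core ℝ E :=
    { inner := fun u v ↦ G y u v
      conj_inner_symm := fun u v ↦ h.symm y hy v u
      re_inner_nonneg := fun u ↦ by
        rcases eq_or_ne u 0 with rfl | hu
        · simp
        · exact (h.pos y hy u hu).le
      add_left := fun u v w ↦ by simp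
      smul_left := fun u v r ↦ by simp
      definite := fun u hu ↦ by
        by_contra hne
        exact (h.pos y hy u hne).ne' hu }
  -- `E` already carries a norm unrelated to `G y`. Passing to a space with only its linear
  -- structure lets the new inner product be installed without a clash.
  have key : ∀ (F : Type _) [AddCommGroup F] [Module ℝ F] (_ : Module.finrank ℝ F = 3)
      (c : InnerProductSpace.Core ℝ F), ∃ b : Module.Basis (Fin 3) ℝ F,
        ∀ i j, c.inner (b i) (b j) = if i = j then 1 else 0 := by
    intro F _ _ hF c
    let _ : NormedAddCommGroup F := c.toNormedAddCommGroup
    let _ : InnerProductSpace ℝ F := InnerProductSpace.ofCore c.toCore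
    have : FiniteDimensional ℝ F := FiniteDimensional.of_finrank_pos (by omega)
    let b := (stdOrthonormalBasis ℝ F).reindex (finCongr hF)
    refine ⟨b.toBasis, fun i j ↦ ?_⟩
    have h := orthonormal_iff_ite.mp b.orthonormal i j
    simpa using! h
  exact key E hE c

theorem riemann_antisymm (G : E → E →L[ℝ] E →L[ℝ] ℝ) (y u v w : E) :
    riemann G y v u w = -riemann G y u v w := by
  rw [riemann_apply, riemann_apply, neg_sub]

variable [FiniteDimensional ℝ E]

theorem traceCLM_smulRight (φ : E →L[ℝ] ℝ) (x : E) : traceCLM E (φ.smulRight x) = φ x :=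
  LinearMap.trace_smulRight (φ : E →ₗ[ℝ] ℝ) x

theorem traceCLM_id : traceCLM E (ContinuousLinearMap.id ℝ E) = Module.finrank ℝ E :=
  LinearMap.trace_id ℝ E

/-- The left side is the Ricci trace. The coefficient of `g (S u) v` is 3 - 1 - 1 = 1: the identity
contributes the dimension, and each of the two rank-one terms removes one. -/
theorem traceCLM_kulkarniNomizu (hE : Module.finrank ℝ E = 3) (g : E →L[ℝ] E →L[ℝ] ℝ)
    (S : E →L[ℝ] E) (u v : E) :
    traceCLM E (swapLast (kulkarniNomizu g S).flip u v) = g (S u) v + traceCLM E S * g u v := by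
  have : swapLast (kulkarniNomizu g S).flip u v = g (S u) v • ContinuousLinearMap.id ℝ E -
      ((g.comp S).flip v).smulRight u + (g u v • S - (g.flip v).smulRight (S u)) := by
    ext a
    rfl
  rw [this]
  simp only [map_add, map_sub, map_smul, traceCLM_smulRight, traceCLM_id, hE, smul_eq_mul,
    ContinuousLinearMap.flip_apply, ContinuousLinearMap.comp_apply]
  push_cast
  ring

theorem traceCLM_eq_sum {ι : Type*} [Fintype ι] [DecidableEq ι] {g : E →L[ℝ] E →L[ℝ] ℝ}
    (b : Module.Basis ι ℝ E) (hb : ∀ i j, g (b i) (b j) = if i = j then 1 else 0)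
    (T : E →L[ℝ] E) : traceCLM E T = ∑ i, g (T (b i)) (b i) := by
  have hrepr : ∀ x i, b.repr x i = g x (b i) := by
    intro x i
    conv_rhs => rw [← b.sum_repr x]
    simp only [map_sum, map_smul, sum_apply, smul_apply, hb, smul_eq_mul,
      mul_ite, mul_one, mul_zero, Finset.sum_ite_eq', Finset.mem_univ, if_true]
  change LinearMap.trace ℝ E (T : E →ₗ[ℝ] E) = _
  rw [LinearMap.trace_eq_matrix_trace ℝ b, Matrix.trace]
  simp [LinearMap.toMatrix_apply, hrepr]

theorem eq_zero_of_antisymm_fin_three {f : Fin 3 → Fin 3 → ℝ} (h : ∀ i j, f j i = -f i j)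
    (h₀₁ : f 0 1 = 0) (h₀₂ : f 0 2 = 0) (h₁₂ : f 1 2 = 0) (i j : Fin 3) : f i j = 0 := by
  fin_cases i <;> fin_cases j <;> dsimp <;>
    linarith [h 0 0, h 1 1, h 2 2, h 0 1, h 0 2, h 1 2]

/-- In dimension three, a tensor with the antisymmetries of a curvature tensor and vanishing Ricci
trace is zero. -/
theorem eq_zero_of_curvatureLike {W : Fin 3 → Fin 3 → Fin 3 → Fin 3 → ℝ}
    (h₁ : ∀ i j k l, W j i k l = -W i j k l) (h₂ : ∀ i j k l, W i j l k = -W i j k l)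
    (h₃ : ∀ j k, W 0 j k 0 + W 1 j k 1 + W 2 j k 2 = 0) (i j k l : Fin 3) : W i j k l = 0 := by
  have a₁ : ∀ i k l, W i i k l = 0 := fun i k l ↦ by linarith [h₁ i i k l]
  have a₂ : ∀ i j k, W i j k k = 0 := fun i j k ↦ by linarith [h₂ i j k k]
  -- With a = W 0 1 0 1, b = W 0 2 0 2 and c = W 1 2 1 2, the diagonal trace equations say a + b = a
  -- + c = b + c = 0, so all three vanish. In an off-diagonal equation `h₃ j k` only the term whose
  -- outer index differs from both j and k survives.
  have r₀ := h₃ 0 0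
  have r₁ := h₃ 1 1
  have r₂ := h₃ 2 2
  rw [a₁, h₁ 0 1 0 1, h₁ 0 2 0 2] at r₀
  rw [a₁, h₂ 0 1 0 1, h₁ 1 2 1 2] at r₁
  rw [a₁, h₂ 0 2 0 2, h₂ 1 2 1 2] at r₂
  refine eq_zero_of_antisymm_fin_three (f := fun i j ↦ W i j k l) (fun i j ↦ h₁ i j k l)
    ?_ ?_ ?_ i j
  · refine eq_zero_of_antisymm_fin_three (h₂ 0 1) (by linarith) ?_ ?_ k l
    · linarith [h₃ 1 2, a₁ 1 2 1, a₂ 2 1 2, h₂ 0 1 0 2]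
    · linarith [h₃ 0 2, a₁ 0 2 0, a₂ 2 0 2, h₂ 1 0 1 2, h₁ 0 1 1 2]
  · refine eq_zero_of_antisymm_fin_three (h₂ 0 2) ?_ (by linarith) ?_ k l
    · linarith [h₃ 2 1, a₁ 2 1 2, a₂ 1 2 1, h₂ 0 2 0 1]
    · linarith [h₃ 0 1, a₁ 0 1 0, a₂ 1 0 1, h₁ 0 2 1 2]
  · refine eq_zero_of_antisymm_fin_three (h₂ 1 2) ?_ ?_ (by linarith) k l
    · linarith [h₃ 2 0, a₁ 2 0 2, a₂ 0 2 0]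
    · linarith [h₃ 1 0, a₁ 1 0 1, a₂ 0 1 0, h₁ 1 2 0 2]

end Algebra

/-! ### Symmetries of the curvature, and its expression by the Schouten tensor. -/

section CurvatureSymmetries

variable {E : Type*} [NormedAddCommGroup E] [NormedSpace ℝ E] [FiniteDimensional ℝ E]
  {G : E → E →L[ℝ] E →L[ℝ] ℝ} {U : Set E} {y : E}

namespace IsMetricOn

theorem fderiv_christoffel_symm (h : IsMetricOn G U) (hy : y ∈ U) (w u v : E) :
    fderiv ℝ (christoffel G) y w u v = fderiv ℝ (christoffel G) y w v u := by
  rw [← fderiv_clm_apply_const₂ (h.differentiableAt_christoffel hy),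
    ← fderiv_clm_apply_const₂ (h.differentiableAt_christoffel hy)]
  have : (fun z ↦ christoffel G z u v) =ᶠ[𝓝 y] fun z ↦ christoffel G z v u := by
    filter_upwards [h.isOpen.mem_nhds hy] with z hz using h.christoffel_symm hz u v
  rw [this.fderiv_eq]

/-- The first Bianchi identity. -/
theorem riemann_cyclic (h : IsMetricOn G U) (hy : y ∈ U) (u v w : E) :
    riemann G y u v w + riemann G y v w u + riemann G y w u v = 0 := by
  simp only [riemann_apply, secondDerivative_apply]
  rw [h.fderiv_christoffel_symm hy u w v, h.fderiv_christoffel_symm hy v w u,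
    h.fderiv_christoffel_symm hy w v u, h.christoffel_symm hy w v, h.christoffel_symm hy w u,
    h.christoffel_symm hy v u]
  abel

/-- The second derivatives of the function G(w, w) commute, while metric compatibility writes their
commutator as 2 G(R_{u,v} w, w). -/
theorem apply_riemann_self (h : IsMetricOn G U) (hy : y ∈ U) (u v w : E) :
    G y (riemann G y u v w) w = 0 := by
  have hG' : DifferentiableAt ℝ (fderiv ℝ G) y :=
    ((contDiffOn_fderiv h.isOpen h.contDiffOn).contDiffAt
      (h.isOpen.mem_nhds hy)).differentiableAt (by simp)
  have hΓ := h.differentiableAt_christoffel hy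
  have key : ∀ u v, fderiv ℝ (fderiv ℝ G) y u v w w =
      2 * (G y (secondDerivative G y u v w) w +
        G y (christoffel G y v w) (christoffel G y u w)) := by
    intro u v
    have h1 : (fun z ↦ fderiv ℝ G z v w w) =ᶠ[𝓝 y] fun z ↦ 2 * G z (christoffel G z v w) w := by
      filter_upwards [h.isOpen.mem_nhds hy] with z hz
      rw [h.fderiv_eq hz, h.symm z hz w]
      ring
    have h2 := DFunLike.congr_fun (h1.fderiv_eq (𝕜 := ℝ)) u
    have d1 := (hΓ.clm_apply (differentiableAt_const v)).clm_apply (differentiableAt_const w)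
    rw [fderiv_clm_apply_const₂ (hG'.clm_apply (differentiableAt_const v)),
      fderiv_clm_apply_const₁ hG', fderiv_const_mul (((h.differentiableAt hy).clm_apply d1).clm_apply
        (differentiableAt_const w)), smul_apply, fderiv_clm_apply₂ (h.differentiableAt hy) d1
        (differentiableAt_const w), fderiv_clm_apply_const₂ hΓ, h.fderiv_eq hy] at h2
    rw [h2, secondDerivative_apply]
    simp only [map_add, add_apply, fderiv_fun_const, Pi.zero_apply, zero_apply, map_zero,
      smul_eq_mul]
    ring
  have h3 := congrArg (fun L : E →L[ℝ] E →L[ℝ] ℝ ↦ L w w)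
    (fderiv_fderiv_apply_comm (h.contDiffAt hy) u v)
  simp only [key] at h3
  rw [riemann_apply, map_sub, sub_apply]
  linarith [h.symm y hy (christoffel G y v w) (christoffel G y u w)]

theorem apply_riemann_antisymm (h : IsMetricOn G U) (hy : y ∈ U) (u v w z : E) :
    G y (riemann G y u v z) w = -G y (riemann G y u v w) z := by
  have h1 := h.apply_riemann_self hy u v (w + z)
  simp only [map_add, add_apply, h.apply_riemann_self hy] at h1
  linarith

/-- A linear combination of the four Bianchi identities obtained by rotating `(u, v, w, z)`,
simplified by the two antisymmetries. -/
theorem apply_riemann_pair_symm (h : IsMetricOn G U) (hy : y ∈ U) (u v w z : E) :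
    G y (riemann G y u v w) z = G y (riemann G y w z u) v := by
  have hb : ∀ a b c d, G y (riemann G y a b c) d + G y (riemann G y b c a) d +
      G y (riemann G y c a b) d = 0 := by
    intro a b c d
    have := congrArg (fun x ↦ G y x d) (h.riemann_cyclic hy a b c)
    simpa using this
  have h1 : ∀ a b c d, G y (riemann G y b a c) d = -G y (riemann G y a b c) d := by
    intro a b c d
    rw [riemann_antisymm, map_neg, neg_apply]
  have h2 := h.apply_riemann_antisymm hy
  linarith [hb u v w z, hb v w z u, hb w z u v, hb z u v w, h1 u v w z, h2 u v w z,
    h1 v w u z, h2 v w u z, h1 w u v z, h2 w u v z, h1 w z u v, h2 w z u v,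
    h1 w z v u, h1 v z w u, h2 v z w u, h1 u z w v, h2 u z w v, h1 z u w v, h1 z u v w, h2 z u v w,
    h1 u w z v, h2 u w z v, h1 v w z u, h1 z v w u, h2 z v w u, h2 v z u w, h1 v z u w]

theorem ricci_symm (h : IsMetricOn G U) (hy : y ∈ U) (hE : Module.finrank ℝ E = 3) (u v : E) :
    ricci G y u v = ricci G y v u := by
  obtain ⟨b, hb⟩ := h.exists_orthonormalBasis hy hE
  have key : ∀ u v, ricci G y u v = ∑ i, G y (riemann G y (b i) u v) (b i) :=
    fun u v ↦ traceCLM_eq_sum b hb (swapLast (riemann G y).flip u v)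
  rw [key, key]
  refine Finset.sum_congr rfl fun i _ ↦ ?_
  rw [h.apply_riemann_pair_symm hy, riemann_antisymm, map_neg, neg_apply,
    h.apply_riemann_antisymm hy, neg_neg]

theorem apply_schoutenSharp (h : IsMetricOn G U) (hy : y ∈ U) (u v : E) :
    G y (schoutenSharp G y u) v = schouten G y u v :=
  DFunLike.congr_fun (h.apply_sharp hy (schouten G y u)) v

theorem schoutenSharp_symm (h : IsMetricOn G U) (hy : y ∈ U) (hE : Module.finrank ℝ E = 3)
    (u v : E) : G y (schoutenSharp G y u) v = G y (schoutenSharp G y v) u := by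
  rw [h.apply_schoutenSharp hy, h.apply_schoutenSharp hy, schouten_apply, schouten_apply,
    h.ricci_symm hy hE, h.symm y hy u v]

/-- A curvature tensor that is a Kulkarni–Nomizu product comes from the Schouten tensor. -/
theorem schoutenSharp_eq_of_riemann_eq (h : IsMetricOn G U) (hy : y ∈ U)
    (hE : Module.finrank ℝ E = 3) {S : E →L[ℝ] E} (hS : riemann G y = kulkarniNomizu (G y) S) :
    schoutenSharp G y = S := by
  have hric : ∀ u v, ricci G y u v = G y (S u) v + traceCLM E S * G y u v := by
    intro u v
    rw [← traceCLM_kulkarniNomizu hE, ← hS]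
    rfl
  have hsharp : (sharp G y).comp (ricci G y) =
      S + traceCLM E S • ContinuousLinearMap.id ℝ E := by
    ext u
    refine h.sharp_eq_of_forall hy fun z ↦ ?_
    simp [hric]
  -- The trace of S + (tr S) id in dimension three is (1 + 3) tr S. Subtracting scal/4 times the
  -- metric therefore removes exactly the trace term of the Ricci tensor.
  have hscal : scal G y = 4 * traceCLM E S := by
    rw [scal, hsharp, map_add, map_smul, traceCLM_id, hE, smul_eq_mul]
    push_cast
    ring
  ext u
  refine h.sharp_eq_of_forall hy fun z ↦ ?_
  change G y (S u) z = schouten G y u z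
  rw [schouten_apply, hric, hscal]
  ring

/-- In dimension three the curvature is determined by the Schouten tensor. -/
theorem riemann_eq_kulkarniNomizu (h : IsMetricOn G U) (hy : y ∈ U)
    (hE : Module.finrank ℝ E = 3) :
    riemann G y = kulkarniNomizu (G y) (schoutenSharp G y) := by
  obtain ⟨b, hb⟩ := h.exists_orthonormalBasis hy hE
  have htr : traceCLM E (schoutenSharp G y) = scal G y / 4 := by
    have : schoutenSharp G y = (sharp G y).comp (ricci G y) -
        (scal G y / 4) • ContinuousLinearMap.id ℝ E := by
      ext u
      refine h.sharp_eq_of_forall hy fun z ↦ ?_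
      have := DFunLike.congr_fun (h.apply_sharp hy (ricci G y u)) z
      simp [schouten_apply, this]
    rw [this, map_sub, map_smul, traceCLM_id, hE, ← scal, smul_eq_mul]
    push_cast
    ring
  -- Both terms have the two antisymmetries. As tr Sch♯ = scal/4, the Ricci trace of the product is
  -- Sch + (scal/4) G = Ric, so the difference has zero Ricci trace.
  set D := riemann G y - kulkarniNomizu (G y) (schoutenSharp G y) with hD
  have hDapply : ∀ u v w, D u v w = riemann G y u v w -
    kulkarniNomizu (G y) (schoutenSharp G y) u v w := fun _ _ _ ↦ rfl
  have hW := eq_zero_of_curvatureLike (W := fun i j k l ↦ G y (D (b i) (b j) (b k)) (b l))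
    (fun i j k l ↦ by
      simp only [hDapply, map_sub, sub_apply, kulkarniNomizu_apply, riemann_antisymm G y (b i) (b j),
        map_neg, neg_apply, map_add, map_smul, add_apply, smul_apply, smul_eq_mul]
      ring)
    (fun i j k l ↦ by
      simp only [hDapply, map_sub, sub_apply, kulkarniNomizu_apply,
        h.apply_riemann_antisymm hy (b i) (b j) (b k) (b l),
        map_add, map_smul, add_apply, smul_apply, smul_eq_mul]
      ring)
    (fun j k ↦ by
      have h1 := traceCLM_eq_sum b hb (swapLast D.flip (b j) (b k))
      have h2 : swapLast D.flip (b j) (b k) = swapLast (riemann G y).flip (b j) (b k) -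
        swapLast (kulkarniNomizu (G y) (schoutenSharp G y)).flip (b j) (b k) := rfl
      have h3 : traceCLM E (swapLast (riemann G y).flip (b j) (b k)) = ricci G y (b j) (b k) := rfl
      rw [h2, map_sub, traceCLM_kulkarniNomizu hE, h3, htr, h.apply_schoutenSharp hy,
        schouten_apply, Fin.sum_univ_three] at h1
      refine h1.symm.trans ?_
      ring)
  rw [← sub_eq_zero, ← hD]
  refine clm_ext_basis b fun i ↦ clm_ext_basis b fun j ↦ clm_ext_basis b fun k ↦ ?_
  refine h.eq_of_forall_apply_eq hy fun z ↦ ?_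
  refine DFunLike.congr_fun (clm_ext_basis (f := G y (D (b i) (b j) (b k))) (g := G y 0) b
    fun l ↦ ?_) z
  simpa using hW i j k l

end IsMetricOn

end CurvatureSymmetries

end CottonGeometry

namespace CottonGeometry

/-! ### Conformal change of metric and the flattening system. -/

section Conformal

variable {E : Type*} [NormedAddCommGroup E] [NormedSpace ℝ E]

/-- The conformally related metric `e^{2f} G`. -/
noncomputable def conformal (f : E → ℝ) (G : E → E →L[ℝ] E →L[ℝ] ℝ) (y : E) :
    E →L[ℝ] E →L[ℝ] ℝ :=
  Real.exp (2 * f y) • G y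

theorem conformal_apply (f : E → ℝ) (G : E → E →L[ℝ] E →L[ℝ] ℝ) (y u v : E) :
    conformal f G y u v = Real.exp (2 * f y) * G y u v :=
  rfl

/-- The right-hand side of the equation `∇_u X = Sch♯ u + G(X, u) X - ½ G(X, X) u`, solved for
the derivative of `X`, for the gradient `X` of the logarithm of a flattening conformal factor. -/
noncomputable def flatteningSystem (G : E → E →L[ℝ] E →L[ℝ] ℝ) [FiniteDimensional ℝ E]
    (p : E × E) : E →L[ℝ] E :=
  schoutenSharp G p.1 - (christoffel G p.1).flip p.2 + (G p.1 p.2).smulRight p.2 -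
    (1 / 2 * G p.1 p.2 p.2) • ContinuousLinearMap.id ℝ E

variable {G : E → E →L[ℝ] E →L[ℝ] ℝ} {U : Set E} {y : E} {f : E → ℝ} {X : E → E}

theorem IsMetricOn.isMetricOn_conformal (h : IsMetricOn G U) (hf : ContDiffOn ℝ ∞ f U) :
    IsMetricOn (conformal f G) U where
  isOpen := h.isOpen
  contDiffOn := (Real.contDiff_exp.comp_contDiffOn (contDiffOn_const.mul hf)).smul h.contDiffOn
  symm y hy u v := by rw [conformal_apply, conformal_apply, h.symm y hy]
  pos y hy u hu := mul_pos (Real.exp_pos _) (h.pos y hy u hu)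

variable [FiniteDimensional ℝ E]

theorem flatteningSystem_apply (G : E → E →L[ℝ] E →L[ℝ] ℝ) (y x v : E) :
    flatteningSystem G (y, x) v = schoutenSharp G y v - christoffel G y v x + G y x v • x -
      (1 / 2 * G y x x) • v :=
  rfl

/-- The right-hand side is symmetric, and its three correction terms account for the derivative of
the factor e^{2f}; uniqueness of the Levi-Civita connection does the rest. -/
theorem IsMetricOn.christoffel_conformal (h : IsMetricOn G U) (hf : ContDiffOn ℝ ∞ f U)
    (hy : y ∈ U) (hX : ∀ v, fderiv ℝ f y v = G y (X y) v) (u v : E) :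
    christoffel (conformal f G) y u v =
      christoffel G y u v + G y (X y) u • v + G y (X y) v • u - G y u v • X y := by
  have hH := h.isMetricOn_conformal hf
  have hfy : DifferentiableAt ℝ f y :=
    (hf.contDiffAt (h.isOpen.mem_nhds hy)).differentiableAt (by simp)
  refine hH.christoffel_eq_of hy (C := fun u v ↦ christoffel G y u v + G y (X y) u • v +
    G y (X y) v • u - G y u v • X y) (fun u v ↦ ?_) (fun w u v ↦ ?_) u v
  · rw [h.christoffel_symm hy v u, h.symm y hy v u]
    abel
  · rw [← fderiv_clm_apply_const₂ (hH.differentiableAt hy)]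
    simp only [conformal_apply]
    have hexp : HasFDerivAt (fun z ↦ Real.exp (2 * f z))
        (Real.exp (2 * f y) • ((2 : ℝ) • fderiv ℝ f y)) y :=
      (hfy.hasFDerivAt.const_mul 2).exp
    have hG2 : DifferentiableAt ℝ (fun z ↦ G z u v) y :=
      ((h.differentiableAt hy).clm_apply (differentiableAt_const u)).clm_apply
        (differentiableAt_const v)
    rw [fderiv_fun_mul hexp.differentiableAt hG2, hexp.fderiv]
    simp only [add_apply, smul_apply, smul_eq_mul, fderiv_clm_apply_const₂ (h.differentiableAt hy),
      hX, h.fderiv_eq hy, map_add, map_sub, map_smul, sub_apply, h.symm y hy u (X y)]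
    rw [h.symm y hy u w]
    ring

theorem IsMetricOn.fderiv_metric_apply (h : IsMetricOn G U) (hy : y ∈ U)
    (hX : DifferentiableAt ℝ X y) (u v : E) :
    fderiv ℝ (fun z ↦ G z (X z) v) y u =
      G y (fderiv ℝ X y u + christoffel G y u (X y)) v + G y (X y) (christoffel G y u v) := by
  rw [fderiv_clm_apply₂ (h.differentiableAt hy) hX (differentiableAt_const v), h.fderiv_eq hy]
  simp only [map_add, add_apply, fderiv_fun_const, Pi.zero_apply, zero_apply, map_zero]
  ring

/-- The Hessian of a function is symmetric. -/
theorem IsMetricOn.hessian_symm (h : IsMetricOn G U) (hf : ContDiffOn ℝ ∞ f U) (hy : y ∈ U)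
    (hXf : ∀ z ∈ U, ∀ v, fderiv ℝ f z v = G z (X z) v) (hX : DifferentiableAt ℝ X y) (u v : E) :
    G y (fderiv ℝ X y u + christoffel G y u (X y)) v =
      G y (fderiv ℝ X y v + christoffel G y v (X y)) u := by
  have hnhds := h.isOpen.mem_nhds hy
  have hf' : DifferentiableAt ℝ (fderiv ℝ f) y :=
    ((contDiffOn_fderiv h.isOpen hf).contDiffAt hnhds).differentiableAt (by simp)
  have key : ∀ u v, fderiv ℝ (fderiv ℝ f) y u v =
      G y (fderiv ℝ X y u + christoffel G y u (X y)) v + G y (X y) (christoffel G y u v) := by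
    intro u v
    rw [← h.fderiv_metric_apply hy hX, ← fderiv_clm_apply_const₁ hf']
    have : (fun z ↦ fderiv ℝ f z v) =ᶠ[𝓝 y] fun z ↦ G z (X z) v := by
      filter_upwards [hnhds] with z hz using hXf z hz v
    rw [this.fderiv_eq]
  have h1 := fderiv_fderiv_apply_comm (hf.contDiffAt hnhds) u v
  rw [key, key, h.christoffel_symm hy v u] at h1
  exact add_right_cancel h1

/-- The curvature of `e^{2f} G`, where `X` is the gradient of `f`. -/
theorem IsMetricOn.riemann_conformal (h : IsMetricOn G U) (hf : ContDiffOn ℝ ∞ f U) (hy : y ∈ U)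
    (hXf : ∀ z ∈ U, ∀ v, fderiv ℝ f z v = G z (X z) v) (hX : DifferentiableAt ℝ X y)
    {S : E →L[ℝ] E} (hS : ∀ u, fderiv ℝ X y u =
      S u - christoffel G y u (X y) + G y (X y) u • X y - (1 / 2 * G y (X y) (X y)) • u) :
    riemann (conformal f G) y = riemann G y - kulkarniNomizu (G y) S := by
  have hnhds := h.isOpen.mem_nhds hy
  have hΓ := h.differentiableAt_christoffel hy
  have hG := h.differentiableAt hy
  have hΓc : ∀ z ∈ U, ∀ u v, _ := fun z hz u v ↦
    h.christoffel_conformal hf hz (hXf z hz) u v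
  -- `S` differs from the Hessian only by terms symmetric with respect to `G`, so it inherits the
  -- symmetry of the Hessian.
  have hSs : ∀ u v, G y (S u) v = G y (S v) u := by
    intro u v
    have h1 := h.hessian_symm hf hy hXf hX u v
    simp only [hS, map_add, map_sub, map_smul, add_apply, sub_apply, smul_apply, smul_eq_mul] at h1
    rw [h.symm y hy v u] at h1
    linarith
  have key : ∀ u v w, fderiv ℝ (christoffel (conformal f G)) y u v w =
      fderiv ℝ (christoffel G) y u v w
      + (G y (fderiv ℝ X y u + christoffel G y u (X y)) v
        + G y (X y) (christoffel G y u v)) • w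
      + (G y (fderiv ℝ X y u + christoffel G y u (X y)) w
        + G y (X y) (christoffel G y u w)) • v
      - (G y v w • fderiv ℝ X y u +
        (G y (christoffel G y u v) w + G y v (christoffel G y u w)) • X y) := by
    intro u v w
    rw [← fderiv_clm_apply_const₂ ((h.isMetricOn_conformal hf).differentiableAt_christoffel hy)]
    have h1 : (fun z ↦ christoffel (conformal f G) z v w) =ᶠ[𝓝 y] fun z ↦
        christoffel G z v w + G z (X z) v • w + G z (X z) w • v - G z v w • X z := by
      filter_upwards [hnhds] with z hz using hΓc z hz v w
    have d1 : DifferentiableAt ℝ (fun z ↦ christoffel G z v w) y :=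
      (hΓ.clm_apply (differentiableAt_const v)).clm_apply (differentiableAt_const w)
    have d2 : ∀ v, DifferentiableAt ℝ (fun z ↦ G z (X z) v) y := fun v ↦
      (hG.clm_apply hX).clm_apply (differentiableAt_const v)
    have d3 : DifferentiableAt ℝ (fun z ↦ G z v w) y :=
      (hG.clm_apply (differentiableAt_const v)).clm_apply (differentiableAt_const w)
    rw [h1.fderiv_eq, fderiv_fun_sub ((d1.fun_add ((d2 v).smul_const w)).fun_add
      ((d2 w).smul_const v)) (d3.fun_smul hX),
      fderiv_fun_add (d1.fun_add ((d2 v).smul_const w)) ((d2 w).smul_const v),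
      fderiv_fun_add d1 ((d2 v).smul_const w), fderiv_smul_const (d2 v), fderiv_smul_const (d2 w),
      fderiv_fun_smul d3 hX]
    simp only [sub_apply, add_apply, smul_apply, ContinuousLinearMap.smulRight_apply,
      h.fderiv_metric_apply hy hX, fderiv_clm_apply_const₂ hΓ, fderiv_clm_apply_const₂ hG,
      h.fderiv_eq hy]
  ext u v w : 3
  simp only [riemann_apply, secondDerivative_apply, key, hΓc y hy, hS, sub_apply,
    kulkarniNomizu_apply]
  simp only [map_add, map_sub, map_smul, add_apply, sub_apply, smul_apply, smul_eq_mul]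
  rw [h.christoffel_symm hy v u, hSs v u, h.symm y hy v u, h.symm y hy u (X y),
    h.symm y hy v (X y)]
  module

/-- The obstruction to the integrability of the flattening system. -/
theorem IsMetricOn.fderiv_flatteningSystem_sub (h : IsMetricOn G U) (hy : y ∈ U)
    (hE : Module.finrank ℝ E = 3) (hX : DifferentiableAt ℝ X y)
    (hX' : fderiv ℝ X y = flatteningSystem G (y, X y)) (u v : E) :
    fderiv ℝ (fun z ↦ flatteningSystem G (z, X z) v) y u -
      fderiv ℝ (fun z ↦ flatteningSystem G (z, X z) u) y v = cottonForm G y u v := by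
  have hΓ := h.differentiableAt_christoffel hy
  have hG := h.differentiableAt hy
  have hP := h.differentiableAt_schoutenSharp hy
  have hXu : ∀ u, fderiv ℝ X y u = _ := fun u ↦
    (DFunLike.congr_fun hX' u).trans (flatteningSystem_apply G y (X y) u)
  have key : ∀ u v, fderiv ℝ (fun z ↦ flatteningSystem G (z, X z) v) y u =
      fderiv ℝ (schoutenSharp G) y u v
      - (fderiv ℝ (christoffel G) y u v (X y) + christoffel G y v (fderiv ℝ X y u))
      + (G y (X y) v • fderiv ℝ X y u +
        (G y (fderiv ℝ X y u + christoffel G y u (X y)) v +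
          G y (X y) (christoffel G y u v)) • X y)
      - G y (fderiv ℝ X y u + christoffel G y u (X y)) (X y) • v := by
    intro u v
    have d1 : DifferentiableAt ℝ (fun z ↦ schoutenSharp G z v) y :=
      hP.clm_apply (differentiableAt_const v)
    have d2 : DifferentiableAt ℝ (fun z ↦ christoffel G z v) y :=
      hΓ.clm_apply (differentiableAt_const v)
    have d3 : DifferentiableAt ℝ (fun z ↦ G z (X z) v) y :=
      (hG.clm_apply hX).clm_apply (differentiableAt_const v)
    have d4 : DifferentiableAt ℝ (fun z ↦ G z (X z) (X z)) y := (hG.clm_apply hX).clm_apply hX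
    simp only [flatteningSystem_apply]
    rw [fderiv_fun_sub ((d1.fun_sub (d2.clm_apply hX)).fun_add (d3.fun_smul hX))
      ((d4.const_mul _).smul_const v),
      fderiv_fun_add (d1.fun_sub (d2.clm_apply hX)) (d3.fun_smul hX),
      fderiv_fun_sub d1 (d2.clm_apply hX), fderiv_fun_smul d3 hX,
      fderiv_smul_const (d4.const_mul _), fderiv_const_mul d4]
    simp only [sub_apply, add_apply, smul_apply, ContinuousLinearMap.smulRight_apply,
      h.fderiv_metric_apply hy hX, fderiv_clm_apply_const₁ hP, fderiv_clm_apply₁ d2 hX,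
      fderiv_clm_apply_const₁ hΓ, fderiv_clm_apply₂ hG hX hX, h.fderiv_eq hy, smul_eq_mul,
      map_add, h.symm y hy (X y)]
    module
  have hR := h.riemann_eq_kulkarniNomizu hy hE
  -- The antisymmetrised derivative of the Christoffel symbols, applied to `X`, is R(u,v)X up to
  -- quadratic Christoffel terms. In dimension three it contains only Sch; a Weyl term would leave
  -- an obstruction depending on `X`.
  have hRX := DFunLike.congr_fun (DFunLike.congr_fun (DFunLike.congr_fun hR u) v) (X y)
  rw [riemann_apply, secondDerivative_apply, secondDerivative_apply, kulkarniNomizu_apply] at hRX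
  have hPs := h.schoutenSharp_symm hy hE
  rw [cottonForm_apply, schoutenDerivative_apply, schoutenDerivative_apply, key, key]
  have : fderiv ℝ (christoffel G) y u v (X y) = fderiv ℝ (christoffel G) y v u (X y) +
     christoffel G y v (christoffel G y u (X y)) - christoffel G y u (christoffel G y v (X y)) +
     (G y (schoutenSharp G y v) (X y) • u - G y (schoutenSharp G y u) (X y) • v +
        (G y v (X y) • schoutenSharp G y u - G y u (X y) • schoutenSharp G y v)) := by
    rw [← hRX]; abel
  simp only [hXu, map_add, map_sub, map_smul, add_apply, sub_apply, smul_apply, smul_eq_mul, this]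
  rw [h.christoffel_symm hy v u, hPs v u, h.symm y hy v u]
  simp only [h.symm y hy _ (X y)]
  module

end Conformal

end CottonGeometry

namespace CottonGeometry

/-! ### Frobenius' theorem for total differential equations. -/

section Frobenius

open Metric Set ODE
open scoped NNReal

variable {E F : Type*} [NormedAddCommGroup E] [NormedSpace ℝ E] [NormedAddCommGroup F]
  [NormedSpace ℝ F]

/-- The Picard–Lindelöf theorem, with a solution that stays in the ball. -/
theorem exists_solution_mem_closedBall [CompleteSpace F] {f : ℝ → F → F} {tmin tmax : ℝ}
    {t₀ : Icc tmin tmax} {x₀ : F} {a L K : ℝ≥0} (hf : IsPicardLindelof f t₀ x₀ a 0 L K) :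
    ∃ α : ℝ → F, α t₀ = x₀ ∧ (∀ t, α t ∈ closedBall x₀ a) ∧
      ∀ t ∈ Icc tmin tmax, HasDerivWithinAt α (f t (α t)) (Icc tmin tmax) t := by
  have hx : x₀ ∈ closedBall x₀ ((0 : ℝ≥0) : ℝ) := mem_closedBall_self le_rfl
  obtain ⟨α, hα⟩ := FunSpace.exists_isFixedPt_next hf hx
  refine ⟨α.compProj, by rw [FunSpace.compProj_val, ← hα, FunSpace.next_apply₀],
    fun t ↦ α.compProj_mem_closedBall hf.mul_max_le, fun t ht ↦ ?_⟩
  apply hasDerivWithinAt_picard_Icc t₀.2 hf.continuousOn_uncurry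
    α.continuous_compProj.continuousOn (fun _ ht' ↦ α.compProj_mem_closedBall hf.mul_max_le)
    x₀ ht |>.congr_of_mem _ ht
  intro t' ht'
  nth_rw 1 [← hα]
  rw [FunSpace.compProj_of_mem ht', FunSpace.next_apply]

/-- Linearity in the error rate `ε` when the initial error is zero lets the factor ‖h‖² be taken out
of the Grönwall estimate. -/
theorem gronwallBound_zero_left (K ε x : ℝ) :
    gronwallBound 0 K ε x = ε * gronwallBound 0 K 1 x := by
  unfold gronwallBound
  split_ifs <;> ring

/-- Solutions, along two neighbouring rays, of an integrable total differential equation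
`dθ = Φ(y, θ)` differ to first order as prescribed by the equation. -/
theorem norm_sub_sub_le_of_integrable {Φ : E × F → E →L[ℝ] F} {Φ' : E × F → E × F →L[ℝ] E →L[ℝ] F}
    {x₀ : E} {θ₀ : F} {ρ : ℝ} {K₀ : ℝ≥0} {K₁ C₀ C₁ : ℝ} (hK₁ : 0 ≤ K₁) (hC₀ : 0 ≤ C₀)
    (hC₁ : 0 ≤ C₁)
    (hd : ∀ q ∈ closedBall (x₀, θ₀) ρ, HasFDerivAt Φ (Φ' q) q)
    (hL₀ : LipschitzOnWith K₀ Φ (closedBall (x₀, θ₀) ρ))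
    (hL₁ : ∀ q ∈ closedBall (x₀, θ₀) ρ, ∀ q' ∈ closedBall (x₀, θ₀) ρ,
      ‖Φ' q - Φ' q'‖ ≤ K₁ * ‖q - q'‖)
    (hΦ : ∀ q ∈ closedBall (x₀, θ₀) ρ, ‖Φ q‖ ≤ C₀)
    (hΦ' : ∀ q ∈ closedBall (x₀, θ₀) ρ, ‖Φ' q‖ ≤ C₁)
    (hint : ∀ q ∈ closedBall (x₀, θ₀) ρ, ∀ u v, Φ' q (u, Φ q u) v = Φ' q (v, Φ q v) u)
    {d h : E} (hdρ : ‖d‖ ≤ ρ) (hhρ : ‖d + h‖ ≤ ρ) (hh : C₀ * ‖h‖ ≤ ρ / 2) {α γ : ℝ → F}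
    (hα₀ : α 0 = θ₀) (hγ₀ : γ 0 = θ₀) (hα : ∀ t, α t ∈ closedBall θ₀ (ρ / 2))
    (hγ : ∀ t, γ t ∈ closedBall θ₀ (ρ / 2))
    (hα' : ∀ t ∈ Icc (0 : ℝ) 1, HasDerivWithinAt α (Φ (x₀ + t • d, α t) d) (Icc 0 1) t)
    (hγ' : ∀ t ∈ Icc (0 : ℝ) 1,
      HasDerivWithinAt γ (Φ (x₀ + t • (d + h), γ t) (d + h)) (Icc 0 1) t) :
    ‖γ 1 - α 1 - Φ (x₀ + d, α 1) h‖ ≤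
      (K₁ * (1 + C₀) ^ 2 * ρ + C₁ * (1 + C₀)) * gronwallBound 0 (K₀ * ρ) 1 1 * ‖h‖ ^ 2 := by
  have hρ : 0 ≤ ρ := (norm_nonneg d).trans hdρ
  have hmem : ∀ {e : E} {t : ℝ} {θ : F}, ‖e‖ ≤ ρ → t ∈ Icc (0 : ℝ) 1 → θ ∈ closedBall θ₀ ρ →
      (x₀ + t • e, θ) ∈ closedBall (x₀, θ₀) ρ := by
    intro e t θ he ht hθ
    rw [← closedBall_prod_same]
    refine ⟨?_, hθ⟩
    rw [mem_closedBall, dist_eq_norm, add_sub_cancel_left, norm_smul, Real.norm_of_nonneg ht.1]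
    nlinarith [ht.1, ht.2, norm_nonneg e]
  have hhalf : closedBall θ₀ (ρ / 2) ⊆ closedBall θ₀ ρ := closedBall_subset_closedBall (by linarith)
  have hq : ∀ t ∈ Icc (0 : ℝ) 1, (x₀ + t • d, α t) ∈ closedBall (x₀, θ₀) ρ := fun t ht ↦
    hmem hdρ ht (hhalf (hα t))
  -- First-order prediction, from `α`, of the solution along the ray in direction `d + h`: at time t
  -- the two rays are `t • h` apart. It solves the equation of `γ` up to O(‖h‖²), and Grönwall then
  -- compares it with `γ`.
  set β : ℝ → F := fun t ↦ α t + Φ (x₀ + t • d, α t) (t • h) with hβ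
  have hβmem : ∀ t ∈ Icc (0 : ℝ) 1, β t ∈ closedBall θ₀ ρ := by
    intro t ht
    have h1 : ‖Φ (x₀ + t • d, α t) (t • h)‖ ≤ C₀ * ‖h‖ := by
      refine (ContinuousLinearMap.le_of_opNorm_le _ (hΦ _ (hq t ht)) _).trans ?_
      rw [norm_smul, Real.norm_of_nonneg ht.1]
      gcongr
      exact mul_le_of_le_one_left (norm_nonneg h) ht.2
    have h2 := mem_closedBall_iff_norm.mp (hα t)
    rw [mem_closedBall_iff_norm, hβ, add_sub_right_comm]
    linarith [norm_add_le (α t - θ₀) (Φ (x₀ + t • d, α t) (t • h))]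
  set β' : ℝ → F := fun t ↦ Φ (x₀ + t • d, α t) d +
    (Φ' (x₀ + t • d, α t) (d, Φ (x₀ + t • d, α t) d) (t • h) + Φ (x₀ + t • d, α t) h) with hβ'
  have hβderiv : ∀ t ∈ Icc (0 : ℝ) 1, HasDerivWithinAt β (β' t) (Icc 0 1) t := by
    intro t ht
    have h1 : HasDerivWithinAt (fun t : ℝ ↦ (x₀ + t • d, α t)) (d, Φ (x₀ + t • d, α t) d)
        (Icc 0 1) t := by
      refine HasDerivWithinAt.prodMk ?_ (hα' t ht)
      simpa using ((hasDerivWithinAt_id t (Icc (0 : ℝ) 1)).smul_const d).const_add x₀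
    have h2 := (hd _ (hq t ht)).comp_hasDerivWithinAt t h1
    have h3 : HasDerivWithinAt (fun t : ℝ ↦ t • h) h (Icc 0 1) t := by
      simpa using (hasDerivWithinAt_id t (Icc (0 : ℝ) 1)).smul_const h
    exact (hα' t ht).add (h2.clm_apply h3)
  set k : ℝ → E × F := fun t ↦ (t • h, Φ (x₀ + t • d, α t) (t • h)) with hk
  have hknorm : ∀ t ∈ Icc (0 : ℝ) 1, ‖k t‖ ≤ (1 + C₀) * ‖h‖ := by
    intro t ht
    have h0 : ‖t • h‖ ≤ ‖h‖ := by
      rw [norm_smul, Real.norm_of_nonneg ht.1]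
      exact mul_le_of_le_one_left (norm_nonneg h) ht.2
    have h1 : ‖Φ (x₀ + t • d, α t) (t • h)‖ ≤ C₀ * ‖h‖ :=
      (ContinuousLinearMap.le_of_opNorm_le _ (hΦ _ (hq t ht)) _).trans (by gcongr)
    have h2 : 0 ≤ C₀ * ‖h‖ := by positivity
    have h3 := norm_nonneg h
    exact max_le (by simp only [hk]; linarith) (by simp only [hk]; linarith)
  have hqk : ∀ t, (x₀ + t • d, α t) + k t = (x₀ + t • (d + h), β t) := by
    intro t
    simp only [hk, hβ, Prod.mk_add_mk, smul_add, add_assoc]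
  have hβbound : ∀ t ∈ Icc (0 : ℝ) 1, dist (β' t) (Φ (x₀ + t • (d + h), β t) (d + h)) ≤
      (K₁ * (1 + C₀) ^ 2 * ρ + C₁ * (1 + C₀)) * ‖h‖ ^ 2 := by
    intro t ht
    set q := (x₀ + t • d, α t) with hqdef
    have hqm : q ∈ closedBall (x₀, θ₀) ρ := hq t ht
    have hqm' : q + k t ∈ closedBall (x₀, θ₀) ρ := by
      rw [hqk]
      exact hmem hhρ ht (hβmem t ht)
    have hTaylor : ‖Φ (q + k t) - Φ q - Φ' q (k t)‖ ≤ K₁ * ‖k t‖ * ‖k t‖ := by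
      have h1 := (convex_segment (𝕜 := ℝ) q (q + k t)).norm_image_sub_le_of_norm_hasFDerivWithin_le'
        (f := Φ) (f' := Φ') (φ := Φ' q) (C := K₁ * ‖k t‖)
        (fun x hx ↦ (hd x ((convex_closedBall _ _).segment_subset hqm hqm' hx)).hasFDerivWithinAt)
        (fun x hx ↦ ?_) (left_mem_segment ℝ q (q + k t)) (right_mem_segment ℝ q (q + k t))
      · simpa using h1
      · refine (hL₁ x ((convex_closedBall _ _).segment_subset hqm hqm' hx) q hqm).trans ?_
        gcongr
        have := norm_sub_le_of_mem_segment hx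
        simpa using this
    have hid : Φ (q + k t) (d + h) - β' t =
        (Φ (q + k t) - Φ q - Φ' q (k t)) (d + h) + Φ' q (k t) h := by
      -- The only use of integrability: exchanging `d` and `t • h` turns the derivative of Φ along
      -- the ray into the linear Taylor term of Φ in the displacement `k t`.
      have h1 : Φ' q (d, Φ q d) (t • h) = Φ' q (k t) d := hint q hqm d (t • h)
      simp only [hβ', ← hqdef, h1, sub_apply, map_add]
      abel
    rw [dist_comm, dist_eq_norm, ← hqk, ← hqdef, hid]
    have hkt := hknorm t ht
    calc _ ≤ ‖(Φ (q + k t) - Φ q - Φ' q (k t)) (d + h)‖ + ‖Φ' q (k t) h‖ := norm_add_le _ _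
      _ ≤ K₁ * ‖k t‖ * ‖k t‖ * ‖d + h‖ + C₁ * ‖k t‖ * ‖h‖ := by
        gcongr
        · exact ContinuousLinearMap.le_of_opNorm_le _ hTaylor _
        · exact ContinuousLinearMap.le_of_opNorm_le _
            (ContinuousLinearMap.le_of_opNorm_le _ (hΦ' q hqm) _) _
      _ ≤ K₁ * ((1 + C₀) * ‖h‖) * ((1 + C₀) * ‖h‖) * ρ + C₁ * ((1 + C₀) * ‖h‖) * ‖h‖ := by
        gcongr
      _ = _ := by ring
  have hIci : ∀ {f : ℝ → F} {f' : F} {t : ℝ}, t ∈ Ico (0 : ℝ) 1 →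
      HasDerivWithinAt f f' (Icc 0 1) t → HasDerivWithinAt f f' (Ici t) t := fun ht hf ↦
    hf.mono_of_mem_nhdsWithin (Icc_mem_nhdsGE_of_mem ht)
  have hLip : ∀ t ∈ Ico (0 : ℝ) 1, LipschitzOnWith (K₀ * ρ.toNNReal)
      (fun θ ↦ Φ (x₀ + t • (d + h), θ) (d + h)) (closedBall θ₀ ρ) := by
    intro t ht
    refine LipschitzOnWith.of_dist_le_mul fun θ hθ θ' hθ' ↦ ?_
    have h1 := hL₀.dist_le_mul _ (hmem hhρ (Ico_subset_Icc_self ht) hθ) _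
      (hmem hhρ (Ico_subset_Icc_self ht) hθ')
    rw [dist_eq_norm, Prod.dist_eq, dist_self, max_eq_right dist_nonneg] at h1
    rw [dist_eq_norm, ← sub_apply, NNReal.coe_mul, Real.coe_toNNReal _ hρ]
    calc _ ≤ K₀ * dist θ θ' * ‖d + h‖ := ContinuousLinearMap.le_of_opNorm_le _ h1 _
      _ ≤ K₀ * dist θ θ' * ρ := by gcongr
      _ = _ := by ring
  have hGron := dist_le_of_approx_trajectories_ODE_of_mem (a := 0) (b := 1) (εf := 0)
    (εg := (K₁ * (1 + C₀) ^ 2 * ρ + C₁ * (1 + C₀)) * ‖h‖ ^ 2) (δ := 0) (f := γ) (g := β)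
    hLip (fun t ht ↦ (hγ' t ht).continuousWithinAt)
    (fun t ht ↦ hIci ht (hγ' t (Ico_subset_Icc_self ht))) (fun t _ ↦ (dist_self _).le)
    (fun t _ ↦ hhalf (hγ t)) (fun t ht ↦ (hβderiv t ht).continuousWithinAt)
    (fun t ht ↦ hIci ht (hβderiv t (Ico_subset_Icc_self ht)))
    (fun t ht ↦ hβbound t (Ico_subset_Icc_self ht)) (fun t ht ↦ hβmem t (Ico_subset_Icc_self ht))
    (by simp [hβ, hα₀, hγ₀]) 1 (right_mem_Icc.mpr zero_le_one)
  rw [dist_eq_norm, zero_add, sub_zero, gronwallBound_zero_left, NNReal.coe_mul,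
    Real.coe_toNNReal _ hρ] at hGron
  simp only [hβ, one_smul] at hGron
  rw [sub_sub]
  refine hGron.trans (le_of_eq ?_)
  ring

/-- **Frobenius' theorem** for an integrable total differential equation `dθ = Φ(y, θ)`. -/
theorem exists_hasFDerivAt_of_integrable [CompleteSpace F] {Φ : E × F → E →L[ℝ] F} {x₀ : E}
    (θ₀ : F) (hΦ : ContDiffAt ℝ 2 Φ (x₀, θ₀))
    (hint : ∀ᶠ q in 𝓝 (x₀, θ₀), ∀ u v,
      fderiv ℝ Φ q (u, Φ q u) v = fderiv ℝ Φ q (v, Φ q v) u) :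
    ∃ θ : E → F, θ x₀ = θ₀ ∧ ∀ᶠ y in 𝓝 x₀, HasFDerivAt θ (Φ (y, θ y)) y := by
  obtain ⟨K₀, s₀, hs₀, hL₀⟩ := (hΦ.of_le (by norm_num)).exists_lipschitzOnWith
  have hΦ1 : ContDiffAt ℝ 1 (fderiv ℝ Φ) (x₀, θ₀) := hΦ.fderiv_right (by norm_num)
  obtain ⟨K₁, s₁, hs₁, hL₁⟩ := hΦ1.exists_lipschitzOnWith
  have e₂ : ∀ᶠ q in 𝓝 (x₀, θ₀), ‖Φ q‖ < ‖Φ (x₀, θ₀)‖ + 1 :=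
    hΦ.continuousAt.norm.eventually_lt continuousAt_const (by linarith)
  have e₃ : ∀ᶠ q in 𝓝 (x₀, θ₀), ‖fderiv ℝ Φ q‖ < ‖fderiv ℝ Φ (x₀, θ₀)‖ + 1 :=
    hΦ1.continuousAt.norm.eventually_lt continuousAt_const (by linarith)
  have e₄ : ∀ᶠ q in 𝓝 (x₀, θ₀), DifferentiableAt ℝ Φ q :=
    (hΦ.eventually (by simp)).mono fun q hq ↦ hq.differentiableAt (by simp)
  obtain ⟨ρ, hρ, hball⟩ := Metric.nhds_basis_closedBall.eventually_iff.mp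
    ((((hint.and e₄).and e₃).and e₂).and (Filter.inter_mem hs₀ hs₁))
  set C₀ := ‖Φ (x₀, θ₀)‖ + 1 with hC₀
  set C₁ := ‖fderiv ℝ Φ (x₀, θ₀)‖ + 1
  have hC₀pos : 1 ≤ C₀ := by simp [hC₀]
  -- Solutions have speed at most `C₀ * r = ρ / 2`, so during unit time they stay in the ball of
  -- radius `ρ / 2`. The other half of `ρ` leaves room for the first-order correction.
  set r := ρ / (2 * C₀) with hr
  have hrpos : 0 < r := by positivity
  have hrC : C₀ * r = ρ / 2 := by
    rw [hr]
    field_simp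
  have hrρ : r ≤ ρ := by nlinarith
  have hmem : ∀ {e : E} {t : ℝ} {θ : F}, ‖e‖ ≤ r → t ∈ Icc (0 : ℝ) 1 →
      θ ∈ closedBall θ₀ (ρ / 2) → (x₀ + t • e, θ) ∈ closedBall (x₀, θ₀) ρ := by
    intro e t θ he ht hθ
    rw [← closedBall_prod_same]
    refine ⟨?_, closedBall_subset_closedBall (by linarith) hθ⟩
    rw [mem_closedBall, dist_eq_norm, add_sub_cancel_left, norm_smul, Real.norm_of_nonneg ht.1]
    nlinarith [ht.1, ht.2, norm_nonneg e]
  have hsol : ∀ d : E, ‖d‖ ≤ r → ∃ α : ℝ → F, α 0 = θ₀ ∧ (∀ t, α t ∈ closedBall θ₀ (ρ / 2)) ∧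
      ∀ t ∈ Icc (0 : ℝ) 1, HasDerivWithinAt α (Φ (x₀ + t • d, α t) d) (Icc 0 1) t := by
    intro d hd
    have hPL : IsPicardLindelof (fun t θ ↦ Φ (x₀ + t • d, θ) d)
        (⟨0, by simp⟩ : Icc (0 : ℝ) 1) θ₀ (ρ / 2).toNNReal 0 (C₀ * r).toNNReal
        (K₀ * r.toNNReal) := by
      have hρ2 : ((ρ / 2).toNNReal : ℝ) = ρ / 2 := Real.coe_toNNReal _ (by positivity)
      have hCr : ((C₀ * r).toNNReal : ℝ) = C₀ * r := Real.coe_toNNReal _ (by positivity)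
      refine ⟨fun t ht ↦ LipschitzOnWith.of_dist_le_mul fun θ hθ θ' hθ' ↦ ?_, fun θ hθ ↦ ?_,
        fun t ht θ hθ ↦ ?_, ?_⟩
      · rw [hρ2] at hθ hθ'
        have h1 := hL₀.dist_le_mul _ (hball (hmem hd ht hθ)).2.1 _ (hball (hmem hd ht hθ')).2.1
        rw [dist_eq_norm, Prod.dist_eq, dist_self, max_eq_right dist_nonneg] at h1
        rw [dist_eq_norm, ← sub_apply, NNReal.coe_mul, Real.coe_toNNReal _ hrpos.le]
        calc _ ≤ K₀ * dist θ θ' * ‖d‖ := ContinuousLinearMap.le_of_opNorm_le _ h1 _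
          _ ≤ K₀ * dist θ θ' * r := by gcongr
          _ = _ := by ring
      · rw [hρ2] at hθ
        intro t ht
        have h1 : ContinuousAt (fun t : ℝ ↦ (x₀ + t • d, θ)) t := by fun_prop
        exact ((((hball (hmem hd ht hθ)).1.1.1.2.continuousAt.comp
          (f := fun t : ℝ ↦ (x₀ + t • d, θ)) h1)).clm_apply
          continuousAt_const).continuousWithinAt
      · rw [hρ2] at hθ
        rw [hCr]
        calc _ ≤ C₀ * ‖d‖ :=
              ContinuousLinearMap.le_of_opNorm_le _ (hball (hmem hd ht hθ)).1.2.le _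
          _ ≤ C₀ * r := by gcongr
      · rw [hρ2, hCr, hrC]
        simp
    obtain ⟨α, h0, h1, h2⟩ := exists_solution_mem_closedBall hPL
    rw [Real.coe_toNNReal _ (by positivity)] at h1
    exact ⟨α, h0, h1, h2⟩
  choose! α hα₀ hα hα' using hsol
  -- The value at `y` is obtained by integrating the equation along the segment from `x₀` to `y`,
  -- parametrised by [0, 1].
  refine ⟨fun y ↦ α (y - x₀) 1, ?_, ?_⟩
  · have h0 := hα' 0 (by simpa using hrpos.le)
    simp only [smul_zero, add_zero, map_zero, sub_self] at h0 ⊢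
    have := constant_of_has_deriv_right_zero (fun t ht ↦ (h0 t ht).continuousWithinAt)
      (fun t ht ↦ (h0 t (Ico_subset_Icc_self ht)).mono_of_mem_nhdsWithin
        (Icc_mem_nhdsGE_of_mem ht)) 1 (right_mem_Icc.mpr zero_le_one)
    rw [this, hα₀ 0 (by simpa using hrpos.le)]
  · filter_upwards [ball_mem_nhds x₀ hrpos] with y hy
    have hy' : ‖y - x₀‖ < r := mem_ball_iff_norm.mp hy
    rw [hasFDerivAt_iff_isLittleO_nhds_zero]
    have hO : (fun h : E ↦ α (y + h - x₀) 1 - α (y - x₀) 1 - Φ (y, α (y - x₀) 1) h) =O[𝓝 0]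
        fun h ↦ ‖h‖ ^ 2 := by
      refine Asymptotics.IsBigO.of_bound ((K₁ * (1 + C₀) ^ 2 * ρ + C₁ * (1 + C₀)) *
        gronwallBound 0 (K₀ * ρ) 1 1) ?_
      have h1 : ∀ᶠ h : E in 𝓝 0, ‖h‖ < r - ‖y - x₀‖ :=
        continuous_norm.continuousAt.eventually_lt continuousAt_const (by simpa using hy')
      filter_upwards [h1] with h hh
      have hyh : ‖y - x₀ + h‖ ≤ r := by linarith [norm_add_le (y - x₀) h]
      have hhr : ‖h‖ ≤ r := by linarith [norm_nonneg (y - x₀)]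
      have key := norm_sub_sub_le_of_integrable (Φ := Φ) (Φ' := fderiv ℝ Φ) (x₀ := x₀) (θ₀ := θ₀)
        (ρ := ρ) (K₀ := K₀) (K₁ := K₁) (C₀ := C₀) (C₁ := C₁) (d := y - x₀) (h := h)
        (α := α (y - x₀)) (γ := α (y - x₀ + h)) K₁.2 (by positivity) (by positivity)
        (fun q hq ↦ (hball hq).1.1.1.2.hasFDerivAt)
        (hL₀.mono fun q hq ↦ (hball hq).2.1)
        (fun q hq q' hq' ↦ by
          rw [← dist_eq_norm, ← dist_eq_norm]
          exact hL₁.dist_le_mul _ (hball hq).2.2 _ (hball hq').2.2)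
        (fun q hq ↦ (hball hq).1.2.le) (fun q hq ↦ (hball hq).1.1.2.le)
        (fun q hq ↦ (hball hq).1.1.1.1) (hy'.le.trans hrρ) (hyh.trans hrρ)
        (by rw [← hrC]; gcongr) (hα₀ _ hy'.le) (hα₀ _ hyh) (hα _ hy'.le) (hα _ hyh)
        (hα' _ hy'.le) (hα' _ hyh)
      rw [add_sub_cancel, ← add_sub_right_comm] at key
      simpa using key
    exact hO.trans_isLittleO (Asymptotics.isLittleO_norm_pow_id one_lt_two)

/-- Solutions of a smooth total differential equation are smooth. -/
theorem contDiffOn_of_hasFDerivAt {Φ : E × F → E →L[ℝ] F} {θ : E → F} {V : Set E} {s : Set (E × F)}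
    (hV : IsOpen V) (hΦ : ContDiffOn ℝ ∞ Φ s) (hs : ∀ y ∈ V, (y, θ y) ∈ s)
    (hθ : ∀ y ∈ V, HasFDerivAt θ (Φ (y, θ y)) y) : ContDiffOn ℝ ∞ θ V := by
  rw [contDiffOn_infty]
  intro n
  induction n with
  | zero =>
    rw [Nat.cast_zero, contDiffOn_zero]
    exact fun y hy ↦ (hθ y hy).continuousAt.continuousWithinAt
  | succ n ih =>
    push_cast
    rw [contDiffOn_succ_iff_fderiv_of_isOpen hV]
    refine ⟨fun y hy ↦ (hθ y hy).differentiableAt.differentiableWithinAt, by simp, ?_⟩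
    -- Bootstrapping: the derivative of `θ` is Φ(y, θ y), hence as regular as `θ`, so each step
    -- gains one derivative.
    refine ContDiffOn.congr (f := fun y ↦ Φ (y, θ y)) ?_ fun y hy ↦ (hθ y hy).fderiv
    exact (hΦ.of_le (by exact_mod_cast le_top)).comp (contDiffOn_id.prodMk ih) hs

end Frobenius

end CottonGeometry

namespace CottonGeometry

/-! ### The theorem in a coordinate domain. -/

section Local

variable {E : Type*} [NormedAddCommGroup E] [NormedSpace ℝ E] [FiniteDimensional ℝ E]
  {G : E → E →L[ℝ] E →L[ℝ] ℝ} {U : Set E} {f : E → ℝ}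

/-- In dimension three, the Cotton form of a conformally flat metric vanishes. -/
theorem IsMetricOn.cottonForm_eq_zero_of_conformal_flat (h : IsMetricOn G U)
    (hE : Module.finrank ℝ E = 3) (hf : ContDiffOn ℝ ∞ f U)
    (hflat : ∀ z ∈ U, riemann (conformal f G) z = 0) {y : E} (hy : y ∈ U) :
    cottonForm G y = 0 := by
  set X : E → E := fun z ↦ sharp G z (fderiv ℝ f z) with hX
  have hXs : ContDiffOn ℝ ∞ X U := h.contDiffOn_sharp.clm_apply (contDiffOn_fderiv h.isOpen hf)
  have hXd : ∀ z ∈ U, DifferentiableAt ℝ X z := fun z hz ↦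
    (hXs.contDiffAt (h.isOpen.mem_nhds hz)).differentiableAt (by simp)
  have hXf : ∀ z ∈ U, ∀ v, fderiv ℝ f z v = G z (X z) v := fun z hz v ↦ by
    rw [hX, h.apply_sharp hz]
  have hX' : ∀ z ∈ U, fderiv ℝ X z = flatteningSystem G (z, X z) := by
    intro z hz
    -- Chosen so that the formula for the conformal curvature applies by construction. Flatness then
    -- says that the curvature of `G` is the Kulkarni–Nomizu product with `S`, which forces S =
    -- Sch♯.
    set S : E →L[ℝ] E := fderiv ℝ X z + (christoffel G z).flip (X z) -
      (G z (X z)).smulRight (X z) + (1 / 2 * G z (X z) (X z)) • ContinuousLinearMap.id ℝ E with hS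
    have h1 := h.riemann_conformal hf hz hXf (hXd z hz) (S := S) fun u ↦ by
      simp [hS]
      abel
    rw [hflat z hz, eq_comm, sub_eq_zero] at h1
    ext u
    rw [flatteningSystem_apply, h.schoutenSharp_eq_of_riemann_eq hz hE h1]
    simp [hS]
    abel
  ext u v : 2
  rw [← h.fderiv_flatteningSystem_sub hy hE (hXd y hy) (hX' y hy)]
  have h2 : ∀ u v, fderiv ℝ (fun z ↦ flatteningSystem G (z, X z) v) y u =
      fderiv ℝ (fderiv ℝ X) y u v := by
    intro u v
    have : (fun z ↦ flatteningSystem G (z, X z) v) =ᶠ[𝓝 y] fun z ↦ fderiv ℝ X z v := by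
      filter_upwards [h.isOpen.mem_nhds hy] with z hz
      rw [hX' z hz]
    rw [this.fderiv_eq, fderiv_clm_apply_const₁]
    exact ((contDiffOn_fderiv h.isOpen hXs).contDiffAt
      (h.isOpen.mem_nhds hy)).differentiableAt (by simp)
  rw [h2, h2, fderiv_fderiv_apply_comm (hXs.contDiffAt (h.isOpen.mem_nhds hy)), sub_self]
  rfl

theorem IsMetricOn.contDiffOn_flatteningSystem (h : IsMetricOn G U) :
    ContDiffOn ℝ ∞ (flatteningSystem G) (U ×ˢ Set.univ) := by
  have hfst : Set.MapsTo (Prod.fst : E × E → E) (U ×ˢ Set.univ) U := fun p hp ↦ hp.1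
  have hP : ContDiffOn ℝ ∞ (fun p : E × E ↦ schoutenSharp G p.1) (U ×ˢ Set.univ) :=
    h.contDiffOn_schoutenSharp.comp contDiffOn_fst hfst
  have hΓ : ContDiffOn ℝ ∞ (fun p : E × E ↦ christoffel G p.1) (U ×ˢ Set.univ) :=
    h.contDiffOn_christoffel.comp contDiffOn_fst hfst
  have hG : ContDiffOn ℝ ∞ (fun p : E × E ↦ G p.1) (U ×ˢ Set.univ) :=
    h.contDiffOn.comp contDiffOn_fst hfst
  have hGX := hG.clm_apply contDiffOn_snd
  rw [contDiffOn_clm_apply]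
  intro v
  have h1 := hP.clm_apply (contDiffOn_const (c := v))
  have h2 := (hΓ.clm_apply (contDiffOn_const (c := v))).clm_apply contDiffOn_snd
  have h3 := (hGX.clm_apply (contDiffOn_const (c := v))).smul contDiffOn_snd
  have h4 := ((contDiffOn_const (c := (1 / 2 : ℝ))).mul (hGX.clm_apply contDiffOn_snd)).smul
    (contDiffOn_const (c := v))
  exact ((h1.sub h2).add h3).sub h4

/-- The obstruction formula requires `X` to satisfy the system only at the one point `y`, so it can
be tested on an affine field with arbitrary value there. -/
theorem IsMetricOn.flatteningSystem_integrable (h : IsMetricOn G U)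
    (hE : Module.finrank ℝ E = 3) {q : E × E} (hq : q.1 ∈ U) (hC : cottonForm G q.1 = 0)
    (u v : E) :
    fderiv ℝ (flatteningSystem G) q (u, flatteningSystem G q u) v =
      fderiv ℝ (flatteningSystem G) q (v, flatteningSystem G q v) u := by
  obtain ⟨y, x⟩ := q
  have hΦ : DifferentiableAt ℝ (flatteningSystem G) (y, x) :=
    (h.contDiffOn_flatteningSystem.contDiffAt
      ((h.isOpen.prod isOpen_univ).mem_nhds ⟨hq, trivial⟩)).differentiableAt (by simp)
  set X : E → E := fun z ↦ x + flatteningSystem G (y, x) (z - y) with hX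
  have hXy : X y = x := by simp [hX]
  have hXd : HasFDerivAt X (flatteningSystem G (y, X y)) y := by
    rw [hXy]
    exact ((flatteningSystem G (y, x)).hasFDerivAt.comp y
      ((hasFDerivAt_id y).sub_const y)).const_add x
  have key : ∀ u v, fderiv ℝ (fun z ↦ flatteningSystem G (z, X z) v) y u =
      fderiv ℝ (flatteningSystem G) (y, x) (u, flatteningSystem G (y, x) u) v := by
    intro u v
    have h1 : HasFDerivAt (fun z ↦ (z, X z))
        ((ContinuousLinearMap.id ℝ E).prod (flatteningSystem G (y, X y))) y :=
      (hasFDerivAt_id y).prodMk hXd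
    rw [← hXy] at hΦ
    have h2 : HasFDerivAt (fun z ↦ flatteningSystem G (z, X z)) _ y := HasFDerivAt.comp
      (g := flatteningSystem G) (f := fun z ↦ (z, X z)) y hΦ.hasFDerivAt h1
    rw [fderiv_clm_apply_const₁ h2.differentiableAt, h2.fderiv, hXy]
    rfl
  have h1 := h.fderiv_flatteningSystem_sub hq hE hXd.differentiableAt hXd.fderiv u v
  rw [key, key, hC] at h1
  exact sub_eq_zero.mp h1

/-- In dimension three, a metric whose Cotton form vanishes is locally conformally flat. -/
theorem IsMetricOn.exists_conformal_flat (h : IsMetricOn G U) (hE : Module.finrank ℝ E = 3)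
    (hC : ∀ z ∈ U, cottonForm G z = 0) {y : E} (hy : y ∈ U) :
    ∃ (V : Set E) (f : E → ℝ), IsOpen V ∧ y ∈ V ∧ V ⊆ U ∧ ContDiffOn ℝ ∞ f V ∧
      ∀ z ∈ V, riemann (conformal f G) z = 0 := by
  obtain ⟨X, -, hX⟩ := exists_hasFDerivAt_of_integrable (Φ := flatteningSystem G) (x₀ := y) 0
    ((h.contDiffOn_flatteningSystem.contDiffAt
      ((h.isOpen.prod isOpen_univ).mem_nhds ⟨hy, trivial⟩)).of_le (ENat.LEInfty.out)) (by
      filter_upwards [(h.isOpen.prod isOpen_univ).mem_nhds (⟨hy, trivial⟩ : (y, (0 : E)) ∈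
        U ×ˢ Set.univ)] with q hq
      exact h.flatteningSystem_integrable hE hq.1 (hC _ hq.1))
  obtain ⟨V₁, hV₁, hV₁o, hyV₁⟩ := eventually_nhds_iff.mp (hX.and (h.isOpen.mem_nhds hy))
  have hV₁U : V₁ ⊆ U := fun z hz ↦ (hV₁ z hz).2
  have hXs : ContDiffOn ℝ ∞ X V₁ := contDiffOn_of_hasFDerivAt hV₁o h.contDiffOn_flatteningSystem
    (fun z hz ↦ ⟨hV₁U hz, trivial⟩) fun z hz ↦ (hV₁ z hz).1
  have h₁ := h.mono hV₁o hV₁U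
  have hXd : ∀ z ∈ V₁, DifferentiableAt ℝ X z := fun z hz ↦ (hV₁ z hz).1.differentiableAt
  have hX' : ∀ z ∈ V₁, ∀ u, fderiv ℝ X z u = schoutenSharp G z u - christoffel G z u (X z) +
      G z (X z) u • X z - (1 / 2 * G z (X z) (X z)) • u := fun z hz u ↦ by
    rw [(hV₁ z hz).1.fderiv, flatteningSystem_apply]
  have hθ : ContDiffOn ℝ ∞ (fun z ↦ G z (X z)) V₁ := h₁.contDiffOn.clm_apply hXs
  have hθs : ContDiffOn ℝ ∞ (fun q : E × ℝ ↦ G q.1 (X q.1)) (V₁ ×ˢ Set.univ) :=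
    hθ.comp contDiffOn_fst fun p hp ↦ hp.1
  -- The equation df = G(X, ·), with right-hand side independent of the unknown, so that
  -- integrability is closedness of this 1-form. It holds because every term of ∇X is symmetric, Sch
  -- included.
  obtain ⟨f, -, hf⟩ := exists_hasFDerivAt_of_integrable (Φ := fun q : E × ℝ ↦ G q.1 (X q.1))
    (x₀ := y) 0 ((hθs.contDiffAt ((hV₁o.prod isOpen_univ).mem_nhds ⟨hyV₁, trivial⟩)).of_le
      (ENat.LEInfty.out)) (by
      filter_upwards [(hV₁o.prod isOpen_univ).mem_nhds (⟨hyV₁, trivial⟩ : (y, (0 : ℝ)) ∈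
        V₁ ×ˢ Set.univ)] with q hq u v
      have hz : q.1 ∈ V₁ := hq.1
      have d1 : DifferentiableAt ℝ (fun z ↦ G z (X z)) q.1 :=
        (hθ.contDiffAt (hV₁o.mem_nhds hz)).differentiableAt (by simp)
      have key : ∀ u v r, fderiv ℝ (fun q : E × ℝ ↦ G q.1 (X q.1)) q (u, r) v =
          G q.1 (fderiv ℝ X q.1 u + christoffel G q.1 u (X q.1)) v +
            G q.1 (X q.1) (christoffel G q.1 u v) := by
        intro u v r
        rw [← h₁.fderiv_metric_apply hz (hXd _ hz), fderiv_clm_apply_const₁ d1]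
        have h2 : HasFDerivAt (fun q : E × ℝ ↦ G q.1 (X q.1)) _ q :=
          d1.hasFDerivAt.comp q hasFDerivAt_fst
        rw [h2.fderiv]
        rfl
      rw [key, key, hX' _ hz, hX' _ hz]
      simp only [map_add, map_sub, map_smul, add_apply, sub_apply, smul_apply, smul_eq_mul]
      rw [h₁.schoutenSharp_symm hz hE v u, h₁.symm _ hz v u, h₁.christoffel_symm hz v u]
      ring)
  obtain ⟨V, hV, hVo, hyV⟩ := eventually_nhds_iff.mp (hf.and (hV₁o.mem_nhds hyV₁))
  have hVV₁ : V ⊆ V₁ := fun z hz ↦ (hV z hz).2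
  have hfs : ContDiffOn ℝ ∞ f V := contDiffOn_of_hasFDerivAt hVo hθs
    (fun z hz ↦ ⟨hVV₁ hz, trivial⟩) fun z hz ↦ (hV z hz).1
  have h₂ := h₁.mono hVo hVV₁
  refine ⟨V, f, hVo, hyV, hVV₁.trans hV₁U, hfs, fun z hz ↦ ?_⟩
  rw [h₂.riemann_conformal hfs hz (fun z hz v ↦ by rw [(hV z hz).1.fderiv])
    (hXd z (hVV₁ hz)) (hX' z (hVV₁ hz)), h₂.riemann_eq_kulkarniNomizu hz hE, sub_self]

end Local

end CottonGeometry

namespace CottonGeometry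

/-! ### Dependence on the germ of the metric only. -/

section Congruence

variable {E : Type*} [NormedAddCommGroup E] [NormedSpace ℝ E]
  {G H : E → E →L[ℝ] E →L[ℝ] ℝ} {y : E}

theorem christoffel_congr (h : G =ᶠ[𝓝 y] H) : christoffel G =ᶠ[𝓝 y] christoffel H := by
  filter_upwards [h, h.fderiv (𝕜 := ℝ)] with z hz hz'
  rw [christoffel, christoffel, christoffelFirst, christoffelFirst, sharp, sharp, hz, hz']

theorem riemann_congr (h : G =ᶠ[𝓝 y] H) : riemann G =ᶠ[𝓝 y] riemann H := by
  filter_upwards [christoffel_congr h, (christoffel_congr h).fderiv (𝕜 := ℝ)] with z hz hz'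
  rw [riemann, riemann, secondDerivative, secondDerivative, hz, hz']

variable [FiniteDimensional ℝ E]

theorem schoutenSharp_congr (h : G =ᶠ[𝓝 y] H) : schoutenSharp G =ᶠ[𝓝 y] schoutenSharp H := by
  filter_upwards [h, riemann_congr h] with z hz hz'
  have h1 : sharp G z = sharp H z := by rw [sharp, sharp, hz]
  have h2 : ricci G z = ricci H z := by rw [ricci, ricci, hz']
  rw [schoutenSharp, schoutenSharp, schouten, schouten, scal, scal, h1, h2, hz]

theorem cottonForm_congr (h : G =ᶠ[𝓝 y] H) : cottonForm G y = cottonForm H y := by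
  have h1 := schoutenSharp_congr h
  rw [cottonForm, cottonForm, schoutenDerivative, schoutenDerivative, h1.fderiv_eq,
    h1.eq_of_nhds, (christoffel_congr h).eq_of_nhds]

theorem cottonForm_antisymm (G : E → E →L[ℝ] E →L[ℝ] ℝ) (y u v : E) :
    cottonForm G y v u = -cottonForm G y u v := by
  rw [cottonForm_apply, cottonForm_apply, neg_sub]

end Congruence

/-! ### Charts, coordinate changes and the passage to the manifold. -/

section Manifold

open Set

local notation "E₃" => EuclideanSpace ℝ (Fin 3)

variable {M : Type*} [TopologicalSpace M] [ChartedSpace E₃ M]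

/-- The differential of the inverse of the preferred chart at `x`. -/
noncomputable def chartDifferential (x : M) (y : E₃) : E₃ →L[ℝ] E₃ :=
  mfderiv 𝓘(ℝ, E₃) (𝓡 3) (extChartAt (𝓡 3) x).symm y

/-- The scalar product at `x`, with the tangent space identified with the model space. -/
noncomputable def modelForm
    (h : ∀ x : M, TangentSpace (𝓡 3) x →L[ℝ] TangentSpace (𝓡 3) x →L[ℝ] ℝ) (x : M) :
    E₃ →L[ℝ] E₃ →L[ℝ] ℝ :=
  h x

theorem inChart_apply (h : ∀ x : M, TangentSpace (𝓡 3) x →L[ℝ] TangentSpace (𝓡 3) x →L[ℝ] ℝ)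
    (x : M) (y u v : E₃) : inChart h x y u v =
      modelForm h ((extChartAt (𝓡 3) x).symm y) (chartDifferential x y u)
        (chartDifferential x y v) :=
  rfl

theorem inChart_conformal (h : ∀ x : M, TangentSpace (𝓡 3) x →L[ℝ] TangentSpace (𝓡 3) x →L[ℝ] ℝ)
    (f : M → ℝ) (x : M) :
    inChart (fun z ↦ Real.exp (2 * f z) • h z) x =
      conformal (fun y ↦ f ((extChartAt (𝓡 3) x).symm y)) (inChart h x) :=
  rfl

/-- The change of coordinates from the preferred chart at `p` to the one at `x`. -/
noncomputable def chartChange (p x : M) (y : E₃) : E₃ :=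
  extChartAt (𝓡 3) x ((extChartAt (𝓡 3) p).symm y)

/-- The domain of the change of coordinates from the chart at `p` to the chart at `x`. -/
def chartChangeDomain (p x : M) : Set E₃ :=
  (extChartAt (𝓡 3) p).target ∩ (extChartAt (𝓡 3) p).symm ⁻¹' (extChartAt (𝓡 3) x).source

theorem isOpen_chartChangeDomain (p x : M) : IsOpen (chartChangeDomain p x) :=
  (continuousOn_extChartAt_symm p).isOpen_inter_preimage (isOpen_extChartAt_target p)
    (isOpen_extChartAt_source x)

theorem extChartAt_mem_chartChangeDomain {x p : M} (hp : p ∈ (extChartAt (𝓡 3) x).source) :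
    extChartAt (𝓡 3) p p ∈ chartChangeDomain p x :=
  ⟨mem_extChartAt_target p, by rwa [mem_preimage, extChartAt_to_inv]⟩

theorem chartChange_extChartAt (p x : M) :
    chartChange p x (extChartAt (𝓡 3) p p) = extChartAt (𝓡 3) x p := by
  rw [chartChange, extChartAt_to_inv]

variable [IsManifold (𝓡 3) ∞ M]

theorem isInvertible_chartDifferential {x : M} {y : E₃} (hy : y ∈ (extChartAt (𝓡 3) x).target) :
    (chartDifferential x y).IsInvertible := by
  have : IsManifold (𝓡 3) 1 M := IsManifold.of_le (n := ∞) (by simp)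
  have h := isInvertible_mfderivWithin_extChartAt_symm (I := 𝓡 3) hy
  rw [ModelWithCorners.range_eq_univ, mfderivWithin_univ] at h
  exact h

theorem mdifferentiableAt_extChartAt_symm' {x : M} {y : E₃}
    (hy : y ∈ (extChartAt (𝓡 3) x).target) :
    MDifferentiableAt 𝓘(ℝ, E₃) (𝓡 3) (extChartAt (𝓡 3) x).symm y := by
  have : IsManifold (𝓡 3) 1 M := IsManifold.of_le (n := ∞) (by simp)
  have h := mdifferentiableWithinAt_extChartAt_symm (I := 𝓡 3) hy
  rwa [ModelWithCorners.range_eq_univ, mdifferentiableWithinAt_univ] at h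

theorem contDiffOn_chartChange (p x : M) :
    ContDiffOn ℝ ∞ (chartChange p x) (chartChangeDomain p x) :=
  contDiffOn_ext_coord_change (I := 𝓡 3) (n := ∞) x p

theorem chartDifferential_eq_comp {p x : M} {y : E₃} (hy : y ∈ chartChangeDomain p x) :
    chartDifferential p y =
      (chartDifferential x (chartChange p x y)).comp (fderiv ℝ (chartChange p x) y) := by
  have hmem : chartChange p x y ∈ (extChartAt (𝓡 3) x).target :=
    (extChartAt (𝓡 3) x).map_source hy.2
  have hF : DifferentiableAt ℝ (chartChange p x) y :=
    ((contDiffOn_chartChange p x).contDiffAt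
      ((isOpen_chartChangeDomain p x).mem_nhds hy)).differentiableAt (by simp)
  have h1 : (extChartAt (𝓡 3) p).symm =ᶠ[𝓝 y] (extChartAt (𝓡 3) x).symm ∘ chartChange p x := by
    filter_upwards [(isOpen_chartChangeDomain p x).mem_nhds hy] with z hz
    exact ((extChartAt (𝓡 3) x).left_inv hz.2).symm
  have h2 := (mdifferentiableAt_extChartAt_symm' hmem).hasMFDerivAt.comp y
    hF.mdifferentiableAt.hasMFDerivAt
  have h3 := (h2.congr_of_eventuallyEq h1).mfderiv
  rw [mfderiv_eq_fderiv] at h3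
  exact h3

theorem isLocalDiffeoOn_chartChange (p x : M) : IsLocalDiffeoOn (chartChange p x)
    (chartChangeDomain p x) (extChartAt (𝓡 3) x).target where
  isOpen := isOpen_chartChangeDomain p x
  contDiffOn := contDiffOn_chartChange p x
  mapsTo y hy := (extChartAt (𝓡 3) x).map_source hy.2
  isInvertible y hy := by
    obtain ⟨a, ha⟩ := isInvertible_chartDifferential hy.1
    obtain ⟨b, hb⟩ := isInvertible_chartDifferential ((extChartAt (𝓡 3) x).map_source hy.2)
    have h := chartDifferential_eq_comp hy
    -- By the chain rule the differential of the coordinate change is b⁻¹a, with `a` and `b` the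
    -- differentials of the two inverse charts.
    refine ⟨a.trans b.symm, ?_⟩
    ext1 u
    have h1 : chartDifferential p y u =
      chartDifferential x (chartChange p x y) (fderiv ℝ (chartChange p x) y u) := by rw [h]; rfl
    rw [← ha, chartChange, ← hb] at h1
    change b.symm (a u) = _
    rw [b.symm_apply_eq]
    exact h1

theorem inChart_eq_pullback (h : ∀ x : M, TangentSpace (𝓡 3) x →L[ℝ] TangentSpace (𝓡 3) x →L[ℝ] ℝ)
    {p x : M} {y : E₃} (hy : y ∈ chartChangeDomain p x) :
    inChart h p y = pullback (chartChange p x) (inChart h x) y := by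
  ext u v
  rw [pullback_apply, inChart_apply, inChart_apply, chartDifferential_eq_comp hy, chartChange,
    (extChartAt (𝓡 3) x).left_inv hy.2]
  rfl

theorem contDiffOn_inChart (g : Metric M) (x : M) :
    ContDiffOn ℝ ∞ (inChart g.inner x) (extChartAt (𝓡 3) x).target := by
  set s := (extChartAt (𝓡 3) x).target with hs
  have hso : IsOpen s := isOpen_extChartAt_target x
  simp only [contDiffOn_clm_apply]
  intro u v
  have hsymm : ContMDiffOn 𝓘(ℝ, E₃) (𝓡 3) ∞ (extChartAt (𝓡 3) x).symm s :=
    contMDiffOn_extChartAt_symm x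
  -- The coordinate vector field is the image of a constant section under the tangent map of the
  -- inverse chart. Pairing two such fields by the smooth metric gives smooth coefficients.
  have hvec : ∀ u : E₃, ContMDiffOn 𝓘(ℝ, E₃) ((𝓡 3).prod 𝓘(ℝ, E₃)) ∞
      (fun y ↦ Bundle.TotalSpace.mk' E₃ (E := fun q : M ↦ TangentSpace (𝓡 3) q)
        ((extChartAt (𝓡 3) x).symm y) (chartDifferential x y u)) s := by
    intro u
    have h1 := hsymm.contMDiffOn_tangentMapWithin (m := ∞) (by simp) hso.uniqueMDiffOn
    have h2 : ContMDiffOn 𝓘(ℝ, E₃) 𝓘(ℝ, E₃).tangent ∞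
        (fun y : E₃ ↦ (⟨y, u⟩ : TangentBundle 𝓘(ℝ, E₃) E₃)) s :=
      contMDiffOn_vectorSpace_iff_contDiffOn.mpr contDiffOn_const
    refine (h1.comp h2 fun y hy ↦ hy).congr fun y hy ↦ ?_
    simp only [Function.comp_apply, tangentMapWithin, mfderivWithin_of_isOpen hso hy]
    rfl
  have h3 : ContMDiffOn 𝓘(ℝ, E₃) ((𝓡 3).prod 𝓘(ℝ, ℝ)) ∞
      (fun y ↦ Bundle.TotalSpace.mk' ℝ (E := Bundle.Trivial M ℝ) ((extChartAt (𝓡 3) x).symm y)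
        (g.inner ((extChartAt (𝓡 3) x).symm y) (chartDifferential x y u)
          (chartDifferential x y v))) s :=
    ContMDiffOn.clm_bundle_apply₂ (F₁ := E₃) (F₂ := E₃) (g.contMDiff.comp_contMDiffOn hsymm)
      (hvec u) (hvec v)
  intro y hy
  have h4 := h3 y hy
  simp only [Bundle.contMDiffWithinAt_totalSpace] at h4
  exact h4.2.contDiffWithinAt

theorem isMetricOn_inChart (g : Metric M) (x : M) :
    IsMetricOn (inChart g.inner x) (extChartAt (𝓡 3) x).target where
  isOpen := isOpen_extChartAt_target x
  contDiffOn := contDiffOn_inChart g x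
  symm _ _ _ _ := g.symm _ _ _
  pos _ hy _ hu := g.pos _ _ fun h ↦
    hu ((isInvertible_chartDifferential hy).injective (h.trans (map_zero _).symm))

/-- A conformal factor may be smooth only on part of a chart, so the coordinate change has to be cut
down to the points that land there. -/
theorem IsLocalDiffeoOn.restrict {E : Type*} [NormedAddCommGroup E] [NormedSpace ℝ E] {F : E → E}
    {W U V : Set E} (hF : IsLocalDiffeoOn F W U) (hV : IsOpen V) :
    IsLocalDiffeoOn F (W ∩ F ⁻¹' V) V where
  isOpen := hF.contDiffOn.continuousOn.isOpen_inter_preimage hF.isOpen hV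
  contDiffOn := hF.contDiffOn.mono inter_subset_left
  mapsTo _ hy := hy.2
  isInvertible y hy := hF.isInvertible y hy.1

/-! ### Independence of the chart. -/

section Transfer

variable {h : ∀ x : M, TangentSpace (𝓡 3) x →L[ℝ] TangentSpace (𝓡 3) x →L[ℝ] ℝ} {x p : M}
  {U : Set E₃}

theorem inChart_eventuallyEq_pullback (hp : p ∈ (extChartAt (𝓡 3) x).source) :
    inChart h p =ᶠ[𝓝 (extChartAt (𝓡 3) p p)] pullback (chartChange p x) (inChart h x) := by
  filter_upwards [(isOpen_chartChangeDomain p x).mem_nhds (extChartAt_mem_chartChangeDomain hp)]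
    with z hz using inChart_eq_pullback h hz

/-- The vanishing of the curvature at a point may be tested in any chart. -/
theorem curvatureTensor_eq_zero_iff (hh : IsMetricOn (inChart h x) U)
    (hp : p ∈ (extChartAt (𝓡 3) x).source) (hpU : extChartAt (𝓡 3) x p ∈ U) :
    curvatureTensor h p = 0 ↔ riemann (inChart h x) (extChartAt (𝓡 3) x p) = 0 := by
  have hF := (isLocalDiffeoOn_chartChange p x).restrict hh.isOpen
  have hy : extChartAt (𝓡 3) p p ∈ chartChangeDomain p x ∩ chartChange p x ⁻¹' U :=
    ⟨extChartAt_mem_chartChangeDomain hp, by rwa [mem_preimage, chartChange_extChartAt]⟩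
  have hA := hF.isInvertible _ hy
  have key := fderiv_riemann_pullback hh hF hy
  rw [chartChange_extChartAt] at key
  change riemann (inChart h p) (extChartAt (𝓡 3) p p) = 0 ↔ _
  rw [(riemann_congr (inChart_eventuallyEq_pullback hp)).eq_of_nhds]
  constructor
  · intro h0
    ext u v w : 3
    obtain ⟨u, rfl⟩ := hA.surjective u
    obtain ⟨v, rfl⟩ := hA.surjective v
    obtain ⟨w, rfl⟩ := hA.surjective w
    rw [← key, h0]
    exact map_zero _
  · intro h0
    ext u v w : 3
    apply hA.injective
    rw [key, h0]
    exact (map_zero _).symm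

/-- The vanishing of the Cotton form at a point may be tested in any chart. -/
theorem cottonFormAt_eq_zero_iff (hh : IsMetricOn (inChart h x) U)
    (hp : p ∈ (extChartAt (𝓡 3) x).source) (hpU : extChartAt (𝓡 3) x p ∈ U) :
    cottonFormAt h p = 0 ↔ cottonForm (inChart h x) (extChartAt (𝓡 3) x p) = 0 := by
  have hF := (isLocalDiffeoOn_chartChange p x).restrict hh.isOpen
  have hy : extChartAt (𝓡 3) p p ∈ chartChangeDomain p x ∩ chartChange p x ⁻¹' U :=
    ⟨extChartAt_mem_chartChangeDomain hp, by rwa [mem_preimage, chartChange_extChartAt]⟩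
  have hA := hF.isInvertible _ hy
  have key := fderiv_cottonForm_pullback hh hF hy
  rw [chartChange_extChartAt] at key
  change cottonForm (inChart h p) (extChartAt (𝓡 3) p p) = 0 ↔ _
  rw [cottonForm_congr (inChart_eventuallyEq_pullback hp)]
  constructor
  · intro h0
    ext u v : 2
    obtain ⟨u, rfl⟩ := hA.surjective u
    obtain ⟨v, rfl⟩ := hA.surjective v
    rw [← key, h0]
    exact map_zero _
  · intro h0
    ext u v : 2
    apply hA.injective
    rw [key, h0]
    exact (map_zero _).symm

end Transfer

theorem eq_zero_of_eq_neg {E : Type*} [AddCommGroup E] [Module ℝ E] {x : E} (h : x = -x) :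
    x = 0 := by
  have h1 : (2 : ℝ) • x = 0 := by
    rw [two_smul]
    nth_rewrite 1 [h]
    exact neg_add_cancel x
  exact (smul_eq_zero.mp h1).resolve_left two_ne_zero

/-- The values of the star on the frame are the values of `α` on the pairs (i + 1, i + 2) modulo 3,
which up to order are all pairs of distinct indices. -/
theorem hodgeStar_eq_zero_iff (g : Metric M) (x : M)
    (o : Orientation ℝ (TangentSpace (𝓡 3) x) (Fin 3))
    {α : TangentSpace (𝓡 3) x →L[ℝ] TangentSpace (𝓡 3) x →L[ℝ] TangentSpace (𝓡 3) x}
    (hα : ∀ u v, α v u = -α u v) : hodgeStar g x o α = 0 ↔ α = 0 := by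
  set b := orientedOrthonormalFrame g x o with hb
  refine ⟨fun h ↦ ?_, fun h ↦ by simp [hodgeStar, h]⟩
  have hself : ∀ u, α u u = 0 := fun u ↦ eq_zero_of_eq_neg (E := E₃) (hα u u)
  have hbasis : ∀ i : Fin 3, α (b (i + 1)) (b (i + 2)) = 0 := by
    intro i
    have h1 := LinearMap.congr_fun h (b i)
    simpa [hodgeStar, ← hb, LinearMap.sum_apply, Module.Basis.coord_apply,
      Finsupp.single_apply] using h1
  have h01 : α (b 0) (b 1) = 0 := hbasis 2
  have h12 : α (b 1) (b 2) = 0 := hbasis 0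
  have h20 : α (b 2) (b 0) = 0 := hbasis 1
  have hall : ∀ i j, α (b i) (b j) = 0 := by
    intro i j
    fin_cases i <;> fin_cases j
    · exact hself _
    · exact h01
    · exact (hα (b 2) (b 0)).trans (by rw [h20, neg_zero])
    · exact (hα (b 0) (b 1)).trans (by rw [h01, neg_zero])
    · exact hself _
    · exact h12
    · exact h20
    · exact (hα (b 1) (b 2)).trans (by rw [h12, neg_zero])
    · exact hself _
  refine ContinuousLinearMap.coe_injective (b.ext fun i ↦ ?_)
  exact ContinuousLinearMap.coe_injective (b.ext fun j ↦ hall i j)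

theorem cottonTensor_eq_zero_iff (g : Metric M) (x : M)
    (o : Orientation ℝ (TangentSpace (𝓡 3) x) (Fin 3)) :
    cottonTensor g x o = 0 ↔ cottonFormAt g.inner x = 0 := by
  rw [← hodgeStar_eq_zero_iff g x o (α := cottonFormAt g.inner x) fun u v ↦
    cottonForm_antisymm (inChart g.inner x) (extChartAt (𝓡 3) x x) u v]
  constructor
  · intro h
    ext1 u
    by_contra hne
    -- Testing the form on the vector *cott(u) itself gives its squared length, so positive
    -- definiteness applies.
    have h1 : cottonTensor g x o u (hodgeStar g x o (cottonFormAt g.inner x) u) = 0 := by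
      rw [h]
      rfl
    rw [cottonTensor_apply] at h1
    exact (g.pos x _ hne).ne' h1
  · intro h
    refine LinearMap.ext fun u ↦ LinearMap.ext fun v ↦ ?_
    rw [cottonTensor_apply, h]
    simp

end Manifold

end CottonGeometry

/-! ### Cotton's theorem. -/

theorem mainTheorem4 {M : Type*} [TopologicalSpace M]
    [ChartedSpace (EuclideanSpace ℝ (Fin 3)) M] [IsManifold (𝓡 3) ∞ M]
    (g : CottonGeometry.Metric M)
    (o : ∀ x : M, Orientation ℝ (TangentSpace (𝓡 3) x) (Fin 3)) :
    CottonGeometry.LocallyConformallyFlat g ↔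
      ∀ x : M, CottonGeometry.cottonTensor g x (o x) = 0 := by
  open CottonGeometry in
  have hE : Module.finrank ℝ (EuclideanSpace ℝ (Fin 3)) = 3 := finrank_euclideanSpace_fin
  simp only [cottonTensor_eq_zero_iff]
  constructor
  · intro h x
    obtain ⟨V, f, hV, hxV, hf, hflat⟩ := h x
    set φ := extChartAt (𝓡 3) x with hφ
    set U := φ.target ∩ φ.symm ⁻¹' V with hU
    have hUo : IsOpen U :=
      (continuousOn_extChartAt_symm x).isOpen_inter_preimage (isOpen_extChartAt_target x) hV
    have hG := (isMetricOn_inChart g x).mono hUo Set.inter_subset_left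
    have hf' : ContDiffOn ℝ ∞ (fun y ↦ f (φ.symm y)) U :=
      (hf.comp ((contMDiffOn_extChartAt_symm x).mono Set.inter_subset_left)
        fun y hy ↦ hy.2).contDiffOn
    refine hG.cottonForm_eq_zero_of_conformal_flat hE hf' (fun z hz ↦ ?_)
      (⟨mem_extChartAt_target x, ?_⟩ : φ x ∈ U)
    · have h1 := (curvatureTensor_eq_zero_iff (h := fun z ↦ Real.exp (2 * f z) • g.inner z)
        (U := U) (x := x) (p := φ.symm z) (hG.isMetricOn_conformal hf') (φ.map_target hz.1)
        (by rw [← hφ, φ.right_inv hz.1]; exact hz)).mp (hflat _ hz.2)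
      rw [← hφ, φ.right_inv hz.1] at h1
      exact h1
    · rwa [Set.mem_preimage, hφ, extChartAt_to_inv]
  · intro h x
    set φ := extChartAt (𝓡 3) x with hφ
    have hG := isMetricOn_inChart g x
    obtain ⟨U, f, hU, hxU, hUt, hf, hflat⟩ := hG.exists_conformal_flat hE (fun z hz ↦ by
      have h1 := (cottonFormAt_eq_zero_iff hG (φ.map_target hz)
        (by rw [← hφ, φ.right_inv hz]; exact hz)).mp (h (φ.symm z))
      rwa [← hφ, φ.right_inv hz] at h1) (mem_extChartAt_target x)
    -- The factor on the manifold is `f` composed with φ. Read back in the chart it is known to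
    -- agree with `f` only on `U`, which is enough because the curvature depends only on germs.
    have hleft : ∀ y ∈ U, f (φ (φ.symm y)) = f y := fun y hy ↦ by rw [φ.right_inv (hUt hy)]
    refine ⟨φ.source ∩ φ ⁻¹' U, fun y ↦ f (φ y),
      (continuousOn_extChartAt x).isOpen_inter_preimage (isOpen_extChartAt_source x) hU,
      ⟨mem_extChartAt_source x, hxU⟩, ?_, fun p hp ↦ ?_⟩
    · exact hf.contMDiffOn.comp ((contMDiffOn_extChartAt (I := 𝓡 3) (n := ∞) (x := x)).mono
        fun y hy ↦ by simpa [hφ] using hy.1) fun y hy ↦ hy.2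
    · have hf' : ContDiffOn ℝ ∞ (fun y ↦ f (φ (φ.symm y))) U := hf.congr hleft
      refine (curvatureTensor_eq_zero_iff (h := fun z ↦ Real.exp (2 * f (φ z)) • g.inner z)
        (U := U) (x := x) ((hG.mono hU hUt).isMetricOn_conformal hf') hp.1 hp.2).mpr ?_
      rw [inChart_conformal g.inner (fun z ↦ f (φ z)) x, ← hflat _ hp.2]
      refine (riemann_congr ?_).eq_of_nhds
      filter_upwards [hU.mem_nhds hp.2] with y hy
      rw [conformal, conformal, ← hφ, hleft y hy]
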